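/- **Theorem (supervised learning is an optimal learning for $\mathcal C(\mathrm{QNN}_{QG})$).** *The machine.* Consider a nonrecurrent gate-model quantum neural network on $n+1$ qubits with unitaries $U_i(\theta_i)=\exp(-i\theta_iP_i)$, $i=1,\dots,L$, where each $P_i$ is a tensor product of Pauli matrices (identity factors allowed). Its environmental graph is a directed acyclic graph on the vertex set $V$ consisting of one input vertex, the $L$ unitaries and one output vertex; no arc enters the input vertex and none leaves the output vertex. The perceptual space is $\mathbb R^d$ (a complex space $\mathbb C^{d'}$ being regarded as $\mathbb R^{2d'}$). An agent is a function $f$ on $\mathbb R^d$ with values in some $\mathbb C^q$, where $f(x)=\big((\gamma_v)_{v\in V},(o_v)_{v\in V}\big)$ collects, for every vertex $v$, the state variable $\gamma_v\in\mathbb C^{2^{n+1}}$ and the value $o_v$ of the output function $F_O$. The transition function is $f_T(v)=\sum_{h\to v}U_v\gamma_h+\beta_v(x)$, where the sum runs over the arcs leading to $v$, $U_v=U_i(\theta_i)$ at the $i$-th unitary and $U_v=I$ at the input and output vertices, and $\beta_v(x)$ is the input system or the bias. The constraints at $v$ are $\zeta_v:\gamma_v-f_T(v)=0$ and $\varphi_v:\wp_v\circ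 F_O=0$ with $\wp_v$ affine, $\wp_v=R_v\gamma_v+C_vo_v-e_v(x)$. With $[\,\cdot\,]\in\{0,1\}$ denoting the truth value, the compact constraint is $\pi(x,f(x))=\sum_{v\in V}([\zeta_v]+[\varphi_v])-2|V|=0$, to be enforced for all $x\in\mathbb R^d$. Let $A$ be the constraint matrix formed from the coefficients of the $\zeta_v$ and $\varphi_v$, and let $b(x)$ be the vector formed from the $\beta_v(x)$ and $e_v(x)$. Assume that $AA^\dagger$ is invertible and that $b$ is smooth with compact support. *The operators.* Let $\ell=\sum_{\kappa=0}^k(-1)^\kappa c_\kappa\nabla^{2\kappa}$ with real constants $c_\kappa$, where $\nabla^2$ is the Laplacian, let $P=(P_1,\dots,P_r)$ be a differential operator with constant complex coefficients such that $\ell=P^\dagger P=\sum_jP_j^\dagger P_j$, and let $\mathcal G:\mathbb R^d\to\mathbb R$ be a continuous integrable Green function of $\ell$, that is, $\ell\,\mathcal G(\cdot-z)=\delta_z$. Call $f$ admissible if $f$ is continuous, $f\in L^2$ and $Pf\in L^2$ in the weak sense. Let $(x_\kappa,y_\kappa)$, $\kappa=1,\dots,N$, $N\ge1$, be arbitrary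 supervised pairs, $x_\kappa\in\mathbb R^d$, $y_\kappa\in\mathbb C^q$. For $\gamma>0$, an *optimal learning* is an admissible $f$ that enforces the compact constraint and minimizes $$\frac\gamma2\langle Pf,Pf\rangle+\frac1{2N}\sum_{\kappa=1}^N\|f(x_\kappa)-y_\kappa\|^2$$ among all admissible agents that enforce it. *Claims.* 1. For every $x$ and every value $w$ of the agent, $\pi(x,w)=0$ if and only if $Aw=b(x)$. 2. $\int_{\mathbb R^d}\mathcal G>0$ (so that $\gamma=\int\mathcal G$ is a possible choice below). 3. For every $\gamma>0$ there is exactly one optimal learning $f^*$. 4. For every $\gamma>0$, a function $f^*:\mathbb R^d\to\mathbb C^q$ is the optimal learning if and only if for all $x$ $$f^*(x)=\frac1\gamma\int_{\mathbb R^d}\mathcal G(z)H(x-z)\,dz+\sum_{\kappa=1}^N\Phi\chi_\kappa\,\mathcal G(x-x_\kappa),$$ where $H=\gamma A^\dagger(AA^\dagger)^{-1}\ell b$, $\Phi=I-A^\dagger(AA^\dagger)^{-1}A$ and $\chi_\kappa=\frac1N\,\frac{y_\kappa-f^*(x_\kappa)}{\gamma}$. 5. For every $\gamma>0$, $f^*$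 is the optimal learning if and only if it is admissible, enforces the compact constraint and satisfies, for some tempered distribution $\lambda$, the Euler–Lagrange equation $$\gamma\,\ell f^*+A^\dagger\lambda+\frac1N\sum_{\kappa=1}^N(f^*(x_\kappa)-y_\kappa)\,\delta_{x_\kappa}=0 .$$ For the optimal $f^*$ the equation holds for exactly one $\lambda$, namely $\lambda=-(AA^\dagger)^{-1}\big(\gamma\,\ell b+\frac1N\sum_\kappa A(f^*(x_\kappa)-y_\kappa)\delta_{x_\kappa}\big)$. 6. For every $\gamma>0$, $f^*$ is the optimal learning if and only if it is admissible and satisfies $\gamma\,\ell f^*=H+\frac1N\sum_{\kappa}\Phi(y_\kappa-f^*(x_\kappa))\,\delta_{x_\kappa}$ in the sense of tempered distributions. -/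

import Mathlib

open MeasureTheory
open scoped SchwartzMap ContDiff Matrix Laplacian LineDeriv

noncomputable section

namespace QNNLearning

/-! ### Gate-model quantum neural networks and their constraint machines -/

/-- Labels of the one-qubit factors of a generalized Pauli operator. -/
inductive Pauli
  | I | X | Y | Z

/-- The one-qubit Pauli matrices. -/
def Pauli.mat : Pauli → Matrix (Fin 2) (Fin 2) ℂ
  | .I => 1
  | .X => !![0, 1; 1, 0]
  | .Y => !![0, -Complex.I; Complex.I, 0]
  | .Z => !![1, 0; 0, -1]

/-- Computational basis of the `n + 1` qubits (`n` data qubits and the readout qubit). -/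
abbrev QBasis (n : ℕ) : Type := Fin (n + 1) → Fin 2

/-- The generalized Pauli operator: the tensor product of one-qubit Pauli matrices. -/
def pauliString {n : ℕ} (s : Fin (n + 1) → Pauli) : Matrix (QBasis n) (QBasis n) ℂ :=
  Matrix.of fun a b => ∏ i, (s i).mat (a i) (b i)

/-- The gate `U(θ) = exp (-i θ P)`. -/
def pauliGate {n : ℕ} (s : Fin (n + 1) → Pauli) (θ : ℝ) : Matrix (QBasis n) (QBasis n) ℂ :=
  NormedSpace.exp ((-(Complex.I * (θ : ℂ))) • pauliString s)

/-- Vertices of the environmental graph: the input system, the `L` unitaries, the output system. -/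
inductive QVertex (L : ℕ)
  | input
  | gate (i : Fin L)
  | output
  deriving DecidableEq, Fintype

/-- The constraint machine of a nonrecurrent gate-model QNN with `n + 1` qubits and `L` unitaries
on the perceptual space `ℝ^d`. -/
structure Machine (d n L : ℕ) where
  /-- the generalized Pauli operator of each unitary -/
  pauli : Fin L → Fin (n + 1) → Pauli
  /-- the gate parameters -/
  θ : Fin L → ℝ
  /-- `arc h v`: there is a directed (quantum) link from `h` to `v` -/
  arc : QVertex L → QVertex L → Prop
  /-- the environmental graph is a directed acyclic graph -/
  acyclic : ∀ v, ¬ Relation.TransGen arc v v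
  arc_input : ∀ h, ¬ arc h .input
  arc_output : ∀ v, ¬ arc .output v
  /-- the additive term of the transition function at a vertex for the individual `x`: the input
  system at the input vertex, the bias at the other ones -/
  bias : QVertex L → EuclideanSpace ℝ (Fin d) → QBasis n → ℂ
  /-- dimension of the output space at a vertex -/
  outDim : QVertex L → ℕ
  /-- number of scalar constraints on the output function at a vertex -/
  conDim : QVertex L → ℕ
  /-- the output constraint at `v` is `℘_v = stateCon v · γ_v + outCon v · F_O - outRhs v x` -/
  stateCon : (v : QVertex L) → Matrix (Fin (conDim v)) (QBasis n) ℂ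
  outCon : (v : QVertex L) → Matrix (Fin (conDim v)) (Fin (outDim v)) ℂ
  outRhs : (v : QVertex L) → EuclideanSpace ℝ (Fin d) → Fin (conDim v) → ℂ

namespace Machine

variable {d n L : ℕ} (M : Machine d n L)

/-- Coordinates of the agent: the state variable of every vertex and the value of the output
function at every vertex. -/
abbrev Col : Type := (QVertex L × QBasis n) ⊕ (Σ v : QVertex L, Fin (M.outDim v))

/-- Index set of the scalar constraints. -/
abbrev Row : Type := (QVertex L × QBasis n) ⊕ (Σ v : QVertex L, Fin (M.conDim v))

/-- The state variable `γ_v` contained in a value `w = f(x)` of the agent. -/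
def state (w : EuclideanSpace ℂ M.Col) (v : QVertex L) : QBasis n → ℂ :=
  fun a => w (Sum.inl (v, a))

/-- The value at `v` of the output function `F_O` contained in a value `w = f(x)` of the agent. -/
def outputValue (w : EuclideanSpace ℂ M.Col) (v : QVertex L) : Fin (M.outDim v) → ℂ :=
  fun j => w (Sum.inr ⟨v, j⟩)

/-- The operator applied at a vertex: `U_i(θ_i)` at the `i`-th unitary, the identity at the input
and output vertices. -/
def vertexGate : QVertex L → Matrix (QBasis n) (QBasis n) ℂ
  | .gate i => pauliGate (M.pauli i) (M.θ i)
  | _ => 1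

open Classical in
/-- The linear transition function `f_T` at `v`: the gate of `v` acts on the states of the
neighbours from which a link leads to `v`. -/
def transition (γ : QVertex L → QBasis n → ℂ) (x : EuclideanSpace ℝ (Fin d)) (v : QVertex L) :
    QBasis n → ℂ :=
  (∑ h : QVertex L, if M.arc h v then M.vertexGate v *ᵥ γ h else 0) + M.bias v x

/-- The constraint `ζ_v : γ_v - f_T = 0`. -/
def TransitionConstraint (x : EuclideanSpace ℝ (Fin d)) (w : EuclideanSpace ℂ M.Col)
    (v : QVertex L) : Prop :=
  M.state w v - M.transition (M.state w) x v = 0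

/-- The constraint `φ_v : ℘_v ∘ F_O = 0`. -/
def OutputConstraint (x : EuclideanSpace ℝ (Fin d)) (w : EuclideanSpace ℂ M.Col)
    (v : QVertex L) : Prop :=
  M.stateCon v *ᵥ M.state w v + M.outCon v *ᵥ M.outputValue w v - M.outRhs v x = 0

open Classical in
/-- The compact constraint `π = ∑_v ([ζ_v] + [φ_v]) - 2|V|`, where `[·]` is the truth value. -/
def compactConstraint (x : EuclideanSpace ℝ (Fin d)) (w : EuclideanSpace ℂ M.Col) : ℤ :=
  (∑ v : QVertex L, ((if M.TransitionConstraint x w v then 1 else 0) +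
    (if M.OutputConstraint x w v then 1 else 0))) - 2 * (Fintype.card (QVertex L) : ℤ)

/-- The agent `f` enforces the compact constraint on the whole perceptual space. -/
def Enforces (f : EuclideanSpace ℝ (Fin d) → EuclideanSpace ℂ M.Col) : Prop :=
  ∀ x, M.compactConstraint x (f x) = 0

open Classical in
/-- The constraint matrix. -/
def A : Matrix M.Row M.Col ℂ :=
  Matrix.fromBlocks
    (1 - Matrix.of fun p q : QVertex L × QBasis n =>
      if M.arc q.1 p.1 then M.vertexGate p.1 p.2 q.2 else 0)
    0
    (Matrix.of fun (p : Σ v : QVertex L, Fin (M.conDim v)) (q : QVertex L × QBasis n) =>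
      if q.1 = p.1 then M.stateCon p.1 p.2 q.2 else 0)
    (Matrix.blockDiagonal' M.outCon)

/-- The right-hand side of the linear form of the constraint. -/
def b (x : EuclideanSpace ℝ (Fin d)) : EuclideanSpace ℂ M.Row :=
  WithLp.toLp 2 (Sum.elim (fun p => M.bias p.1 x p.2) (fun p => M.outRhs p.1 x p.2))

end Machine

/-! ### Differential operators with constant coefficients -/

section Operators

variable {d : ℕ} {F : Type*} [NormedAddCommGroup F]

/-- The differential operator `ℓ = ∑_{κ ≤ k} (-1)^κ c_κ ∇^{2κ}` on functions. -/
def ell [NormedSpace ℝ F] (k : ℕ) (c : ℕ → ℝ) (f : EuclideanSpace ℝ (Fin d) → F)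
    (x : EuclideanSpace ℝ (Fin d)) : F :=
  ∑ κ ∈ Finset.range (k + 1),
    ((-1) ^ κ * c κ) • ((Δ : (EuclideanSpace ℝ (Fin d) → F) → _)^[κ] f) x

/-- The polynomial of `ℓ` in the partial derivatives. -/
def ellPoly (d k : ℕ) (c : ℕ → ℝ) : MvPolynomial (Fin d) ℂ :=
  ∑ κ ∈ Finset.range (k + 1),
    MvPolynomial.C (((-1) ^ κ * c κ : ℝ) : ℂ) * (∑ i, MvPolynomial.X i ^ 2) ^ κ

/-- The transpose `p(-∂)` of the operator `p(∂)`. -/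
def transposeOp (p : MvPolynomial (Fin d) ℂ) : MvPolynomial (Fin d) ℂ :=
  MvPolynomial.aeval (fun i => -MvPolynomial.X i) p

/-- The (formal `L²`) adjoint `p†` of the operator `p(∂)`. -/
def adjointOp (p : MvPolynomial (Fin d) ℂ) : MvPolynomial (Fin d) ℂ :=
  transposeOp (MvPolynomial.map (starRingEnd ℂ) p)

/-- `p(∂) φ` for a Schwartz function `φ`. -/
def diffOp (p : MvPolynomial (Fin d) ℂ) (φ : 𝓢(EuclideanSpace ℝ (Fin d), ℂ)) :
    𝓢(EuclideanSpace ℝ (Fin d), ℂ) :=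
  ∑ α ∈ p.support, p.coeff α •
    (List.ofFn fun i : Fin d =>
      (LineDeriv.lineDerivOpCLM ℂ 𝓢(EuclideanSpace ℝ (Fin d), ℂ)
        (EuclideanSpace.single i (1 : ℝ))) ^ (α i)).prod φ

/-- `g ∈ L²` is the weak value of `p(∂) f`. -/
def IsWeakDiff [NormedSpace ℂ F] (p : MvPolynomial (Fin d) ℂ)
    (f g : EuclideanSpace ℝ (Fin d) → F) : Prop :=
  MemLp g 2 volume ∧ ∀ φ : 𝓢(EuclideanSpace ℝ (Fin d), ℂ),
    ∫ x, diffOp (transposeOp p) φ x • f x = ∫ x, φ x • g x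

open Classical in
/-- `p(∂) f` in the weak sense (unique almost everywhere where it exists). -/
def weakDiff [NormedSpace ℂ F] (p : MvPolynomial (Fin d) ℂ)
    (f : EuclideanSpace ℝ (Fin d) → F) : EuclideanSpace ℝ (Fin d) → F :=
  if h : ∃ g, IsWeakDiff p f g then h.choose else 0

/-- The differential operator `P = (P_1, …, P_r)` satisfies `ℓ = P† P`. -/
def IsFactorization {r : ℕ} (k : ℕ) (c : ℕ → ℝ) (P : Fin r → MvPolynomial (Fin d) ℂ) : Prop :=
  ∑ j, adjointOp (P j) * P j = ellPoly d k c

/-- The functional space: continuous square integrable functions `f` with `P f ∈ L²`. -/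
def Admissible [NormedSpace ℂ F] {r : ℕ} (P : Fin r → MvPolynomial (Fin d) ℂ)
    (f : EuclideanSpace ℝ (Fin d) → F) : Prop :=
  Continuous f ∧ MemLp f 2 volume ∧ ∀ j, ∃ g, IsWeakDiff (P j) f g

/-- `⟨P f, P f⟩`. -/
def energy [NormedSpace ℂ F] {r : ℕ} (P : Fin r → MvPolynomial (Fin d) ℂ)
    (f : EuclideanSpace ℝ (Fin d) → F) : ℝ :=
  ∑ j, ∫ x, ‖weakDiff (P j) f x‖ ^ 2

/-- `G` is a Green function of `ℓ`: a continuous integrable function with `ℓ G = δ`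
(the translation invariant kernel is `G (x - z)`). -/
structure IsGreen (k : ℕ) (c : ℕ → ℝ) (G : EuclideanSpace ℝ (Fin d) → ℝ) : Prop where
  continuous : Continuous G
  integrable : Integrable G volume
  eq_delta : ∀ φ : 𝓢(EuclideanSpace ℝ (Fin d), ℂ), ∫ x, G x • ell k c (⇑φ) x = φ 0

end Operators

/-! ### Supervised learning under the compact constraint -/

section Learning

variable {d n L N : ℕ} (M : Machine d n L)

/-- The functional of supervised learning: the energy with weight `γ` and the mean quadratic loss
on the supervised pairs. -/
def objective {r : ℕ} (P : Fin r → MvPolynomial (Fin d) ℂ) (γ : ℝ)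
    (xs : Fin N → EuclideanSpace ℝ (Fin d)) (ys : Fin N → EuclideanSpace ℂ M.Col)
    (f : EuclideanSpace ℝ (Fin d) → EuclideanSpace ℂ M.Col) : ℝ :=
  γ / 2 * energy P f + 1 / (2 * (N : ℝ)) * ∑ κ, ‖f (xs κ) - ys κ‖ ^ 2

/-- `f` is an optimal supervised learning of the constraint machine. -/
def IsOptimal {r : ℕ} (P : Fin r → MvPolynomial (Fin d) ℂ) (γ : ℝ)
    (xs : Fin N → EuclideanSpace ℝ (Fin d)) (ys : Fin N → EuclideanSpace ℂ M.Col)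
    (f : EuclideanSpace ℝ (Fin d) → EuclideanSpace ℂ M.Col) : Prop :=
  (Admissible P f ∧ M.Enforces f) ∧
    ∀ g, Admissible P g → M.Enforces g → objective M P γ xs ys f ≤ objective M P γ xs ys g

/-- The Euler–Lagrange equation
`γ ℓ f + A† λ + (1/N) ∑ (f - y_κ) δ(x - x_κ) = 0` in the sense of tempered distributions. -/
def EulerLagrange (k : ℕ) (c : ℕ → ℝ) (γ : ℝ)
    (xs : Fin N → EuclideanSpace ℝ (Fin d)) (ys : Fin N → EuclideanSpace ℂ M.Col)
    (f : EuclideanSpace ℝ (Fin d) → EuclideanSpace ℂ M.Col)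
    (lam : 𝓢'(EuclideanSpace ℝ (Fin d), EuclideanSpace ℂ M.Row)) : Prop :=
  ∀ φ : 𝓢(EuclideanSpace ℝ (Fin d), ℂ),
    γ • (∫ x, ell k c (⇑φ) x • f x) + Matrix.toEuclideanLin M.Aᴴ (lam φ)
      + (1 / (N : ℝ)) • ∑ κ, φ (xs κ) • (f (xs κ) - ys κ) = 0

/-- The explicit Lagrange multiplier
`λ = -(A A†)⁻¹ (γ ℓ b + (1/N) ∑ A (f - y_κ) δ(x - x_κ))`, tested against `φ`. -/
def multiplier (k : ℕ) (c : ℕ → ℝ) (γ : ℝ)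
    (xs : Fin N → EuclideanSpace ℝ (Fin d)) (ys : Fin N → EuclideanSpace ℂ M.Col)
    (f : EuclideanSpace ℝ (Fin d) → EuclideanSpace ℂ M.Col)
    (φ : 𝓢(EuclideanSpace ℝ (Fin d), ℂ)) : EuclideanSpace ℂ M.Row :=
  -Matrix.toEuclideanLin (M.A * M.Aᴴ)⁻¹
    (γ • (∫ x, φ x • ell k c M.b x)
      + (1 / (N : ℝ)) • ∑ κ, φ (xs κ) • Matrix.toEuclideanLin M.A (f (xs κ) - ys κ))

/-- `H = γ A† (A A†)⁻¹ ℓ b`. -/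
def H (k : ℕ) (c : ℕ → ℝ) (γ : ℝ) (x : EuclideanSpace ℝ (Fin d)) : EuclideanSpace ℂ M.Col :=
  γ • Matrix.toEuclideanLin (M.Aᴴ * (M.A * M.Aᴴ)⁻¹) (ell k c M.b x)

/-- `Φ = I - A† (A A†)⁻¹ A`. -/
def Phi : Matrix M.Col M.Col ℂ := 1 - M.Aᴴ * (M.A * M.Aᴴ)⁻¹ * M.A

/-- The Euler–Lagrange equation with the multiplier eliminated:
`γ ℓ f = H + (1/N) ∑ Φ (y_κ - f) δ(x - x_κ)`. -/
def ReducedEulerLagrange (k : ℕ) (c : ℕ → ℝ) (γ : ℝ)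
    (xs : Fin N → EuclideanSpace ℝ (Fin d)) (ys : Fin N → EuclideanSpace ℂ M.Col)
    (f : EuclideanSpace ℝ (Fin d) → EuclideanSpace ℂ M.Col) : Prop :=
  ∀ φ : 𝓢(EuclideanSpace ℝ (Fin d), ℂ),
    γ • (∫ x, ell k c (⇑φ) x • f x) = (∫ x, φ x • H M k c γ x)
      + (1 / (N : ℝ)) • ∑ κ, φ (xs κ) • Matrix.toEuclideanLin (Phi M) (ys κ - f (xs κ))

/-- `χ_κ = (1/N) (y_κ - f(x_κ)) / γ`. -/
def chi (γ : ℝ) (xs : Fin N → EuclideanSpace ℝ (Fin d)) (ys : Fin N → EuclideanSpace ℂ M.Col)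
    (f : EuclideanSpace ℝ (Fin d) → EuclideanSpace ℂ M.Col) (κ : Fin N) : EuclideanSpace ℂ M.Col :=
  (1 / ((N : ℝ) * γ)) • (ys κ - f (xs κ))

/-- The explicit representation
`f(x) = (1/γ) ∫ G(z) H(x - z) dz + ∑ Φ χ_κ G(x - x_κ)`. -/
def Representation (k : ℕ) (c : ℕ → ℝ) (G : EuclideanSpace ℝ (Fin d) → ℝ) (γ : ℝ)
    (xs : Fin N → EuclideanSpace ℝ (Fin d)) (ys : Fin N → EuclideanSpace ℂ M.Col)
    (f : EuclideanSpace ℝ (Fin d) → EuclideanSpace ℂ M.Col) : Prop :=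
  ∀ x, f x = (1 / γ) • (∫ z, G z • H M k c γ (x - z))
    + ∑ κ, G (x - xs κ) • Matrix.toEuclideanLin (Phi M) (chi M γ xs ys f κ)

end Learning

end QNNLearning

end

/-! At every `x` the compact constraint is the linear system `A w = b(x)`. Since `A A†` is
invertible, the enforcing functions are `B = A†(A A†)⁻¹ b` plus functions with values in `ker A`,
and `Φ` is the orthogonal projection onto `ker A`. The variational problem is then of the
representer-theorem type, solved on the Fourier side.

Let `m(ξ) = ∑ c_κ (4π²‖ξ‖²)^κ` be the symbol of `ℓ`. The factorization `ℓ = P†P` gives `m = ∑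
|P_j(2πiξ)|² ≥ 0`, and `ℓ G = δ` gives `m Ĝ = 1`. Hence `m > 0` and `Ĝ = 1/m`; at `ξ = 0` this is `∫
G = 1/m(0) > 0`. As `Ĝ` is nonnegative and `G` is continuous at the origin, `1/m` is integrable
(`integrable_inv_ellSymb`). The energy of `f` is `∫ m |f̂|²`, so finite energy makes `f̂`
integrable, `f` is the inverse transform of `f̂` at every point, and `G` reproduces point values for
the energy inner product (`integral_inner_kernelFourier`).

The candidate is `f = B + ∑ G(· - x_κ) Φχ_κ`. It is implicit, as `χ_κ` contains `f(x_κ)`, but the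
resulting finite system is solvable because the kernel matrix of `G` is positive semidefinite
(`exists_kernel_coefficients`). For another admissible enforcing `g`, the difference `v = g - f`
takes values in `ker A`. In the energy, the cross term with `ℓB` vanishes because `ℓB` lies in the
range of `A†`; the remaining one cancels the cross term of the loss. So the objective grows by
exactly `γ/2 · energy(v) + 1/(2N) ∑ ‖v(x_κ)‖²` (`objective_eq_add`). As the energy vanishes only at
`v = 0`, this gives existence, uniqueness and the representation with no compactness argument.

Applying `A` to the Euler–Lagrange equation determines the multiplier; substituting it back leaves
the reduced equation, whose admissible solution is the candidate because `ℓ` is injective on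
continuous `L²` functions. -/

namespace QNNLearning

open FourierTransform ComplexConjugate Filter Topology

/-! ### Square integrable Fourier pairs of functions -/

section FourierPairs

variable {V F : Type*} [NormedAddCommGroup V] [InnerProductSpace ℝ V] [FiniteDimensional ℝ V]
  [MeasurableSpace V] [BorelSpace V] [NormedAddCommGroup F] [InnerProductSpace ℂ F]

/-- Locally integrable functions with the same integrals against all Schwartz functions are
almost everywhere equal. -/
theorem ae_eq_of_forall_integral_schwartz_smul_eq [CompleteSpace F] {f g : V → F}
    (hf : LocallyIntegrable f) (hg : LocallyIntegrable g)
    (h : ∀ φ : 𝓢(V, ℂ), ∫ x, φ x • f x = ∫ x, φ x • g x) : f =ᵐ[volume] g := by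
  let _ : NormedSpace ℝ F := NormedSpace.restrictScalars ℝ ℂ F
  apply ae_eq_of_integral_contDiff_smul_eq hf hg
  intro u hu hus
  have hu' : ContDiff ℝ ∞ (fun x => (u x : ℂ)) := Complex.ofRealCLM.contDiff.comp hu
  have hus' : HasCompactSupport (fun x => (u x : ℂ)) :=
    hus.comp_left (g := fun t : ℝ => (t : ℂ)) Complex.ofReal_zero
  have := h (hus'.toSchwartzMap hu')
  simpa using! this

/-- `h` is the `L²` Fourier transform of `f`. -/
structure FourierL2 (f h : V → F) : Prop where
  left : MemLp f 2 volume
  right : MemLp h 2 volume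
  integral_eq : ∀ φ : 𝓢(V, ℂ), ∫ x, (𝓕 φ) x • f x = ∫ x, φ x • h x

theorem _root_.MeasureTheory.MemLp.integrable_schwartz_smul {f : V → F} (hf : MemLp f 2 volume)
    (φ : 𝓢(V, ℂ)) : Integrable (fun x => φ x • f x) := by
  have := MemLp.smul (p := 2) (q := 2) (r := 1) hf (φ.memLp 2 volume)
  exact memLp_one_iff_integrable.1 this

/-- The `L²` transform agrees with that of tempered distributions. Stating the relation for
functions rather than classes keeps point values of continuous representatives available. -/
theorem fourierL2_toLp [CompleteSpace F] (f : Lp F 2 (volume : Measure V)) :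
    FourierL2 f (𝓕 f : Lp F 2 (volume : Measure V)) := by
  refine ⟨Lp.memLp _, Lp.memLp _, fun φ => ?_⟩
  have := congrArg (fun T : 𝓢'(V, F) => T φ) (Lp.fourier_toTemperedDistribution_eq f)
  simpa [TemperedDistribution.fourier_apply, Lp.toTemperedDistribution_apply] using this

theorem _root_.MeasureTheory.MemLp.exists_fourierL2 [CompleteSpace F] {f : V → F}
    (hf : MemLp f 2 volume) : ∃ h, FourierL2 f h := by
  refine ⟨(𝓕 (hf.toLp f) : Lp F 2 (volume : Measure V)), hf, Lp.memLp _, fun φ => ?_⟩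
  rw [← (fourierL2_toLp (hf.toLp f)).integral_eq φ]
  refine integral_congr_ae ?_
  filter_upwards [hf.coeFn_toLp] with x hx
  rw [hx]

theorem _root_.MeasureTheory.MemLp.exists_fourierL2_symm [CompleteSpace F] {h : V → F}
    (hh : MemLp h 2 volume) : ∃ f, FourierL2 f h := by
  refine ⟨(𝓕⁻ (hh.toLp h) : Lp F 2 (volume : Measure V)), Lp.memLp _, hh, fun φ => ?_⟩
  rw [(fourierL2_toLp (𝓕⁻ (hh.toLp h) : Lp F 2 (volume : Measure V))).integral_eq φ,
    fourier_fourierInv_eq]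
  refine integral_congr_ae ?_
  filter_upwards [hh.coeFn_toLp] with x hx
  rw [hx]

namespace FourierL2

variable {f h f' h' : V → F}

theorem unique_right [CompleteSpace F] (H : FourierL2 f h) (H' : FourierL2 f' h')
    (e : f =ᵐ[volume] f') : h =ᵐ[volume] h' := by
  refine ae_eq_of_forall_integral_schwartz_smul_eq (H.right.locallyIntegrable one_le_two)
    (H'.right.locallyIntegrable one_le_two) fun φ => ?_
  rw [← H.integral_eq, ← H'.integral_eq]
  refine integral_congr_ae ?_
  filter_upwards [e] with x hx
  rw [hx]

theorem unique_left [CompleteSpace F] (H : FourierL2 f h) (H' : FourierL2 f' h')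
    (e : h =ᵐ[volume] h') : f =ᵐ[volume] f' := by
  refine ae_eq_of_forall_integral_schwartz_smul_eq (H.left.locallyIntegrable one_le_two)
    (H'.left.locallyIntegrable one_le_two) fun φ => ?_
  -- Every Schwartz function is the transform of `𝓕⁻ φ`, so the defining identity tests `f` against
  -- arbitrary `φ`.
  have h1 := H.integral_eq (𝓕⁻ φ)
  have h2 := H'.integral_eq (𝓕⁻ φ)
  rw [fourier_fourierInv_eq] at h1 h2
  rw [h1, h2]
  refine integral_congr_ae ?_
  filter_upwards [e] with x hx
  rw [hx]

theorem congr (H : FourierL2 f h) (e : f =ᵐ[volume] f') (e' : h =ᵐ[volume] h') :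
    FourierL2 f' h' := by
  refine ⟨H.left.ae_eq e, H.right.ae_eq e', fun φ => ?_⟩
  have h1 : (fun x => (𝓕 φ) x • f x) =ᵐ[volume] fun x => (𝓕 φ) x • f' x :=
    e.mono fun x hx => by simp only [hx]
  have h2 : (fun x => φ x • h x) =ᵐ[volume] fun x => φ x • h' x :=
    e'.mono fun x hx => by simp only [hx]
  rw [← integral_congr_ae h1, ← integral_congr_ae h2, H.integral_eq φ]

theorem toLp_eq [CompleteSpace F] (H : FourierL2 f h) :
    𝓕 (H.left.toLp f) = H.right.toLp h := by
  have h1 := (fourierL2_toLp (H.left.toLp f)).unique_right H H.left.coeFn_toLp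
  exact Lp.ext (h1.trans H.right.coeFn_toLp.symm)

/-- Plancherel's theorem. -/
theorem integral_inner [CompleteSpace F] (H : FourierL2 f h) (H' : FourierL2 f' h') :
    ∫ x, inner ℂ (f x) (f' x) = ∫ x, inner ℂ (h x) (h' x) := by
  have := Lp.inner_fourier_eq (H.left.toLp f) (H'.left.toLp f')
  rw [H.toLp_eq, H'.toLp_eq, L2.inner_def, L2.inner_def] at this
  rw [integral_congr_ae (g := fun x => inner ℂ (H.left.toLp f x) (H'.left.toLp f' x)), ← this]
  · refine integral_congr_ae ?_
    filter_upwards [H.right.coeFn_toLp, H'.right.coeFn_toLp] with x hx hx'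
    rw [hx, hx']
  · filter_upwards [H.left.coeFn_toLp, H'.left.coeFn_toLp] with x hx hx'
    rw [hx, hx']

theorem integral_norm_sq [CompleteSpace F] (H : FourierL2 f h) :
    ∫ x, ‖f x‖ ^ 2 = ∫ x, ‖h x‖ ^ 2 := by
  apply Complex.ofRealLI.injective
  have := H.integral_inner H
  simpa [← LinearIsometry.integral_comp_comm, inner_self_eq_norm_sq_to_K] using this

theorem add (H : FourierL2 f h) (H' : FourierL2 f' h') :
    FourierL2 (fun x => f x + f' x) (fun x => h x + h' x) := by
  refine ⟨H.left.add H'.left, H.right.add H'.right, fun φ => ?_⟩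
  simp only [smul_add]
  rw [integral_add (H.left.integrable_schwartz_smul _) (H'.left.integrable_schwartz_smul _),
    integral_add (H.right.integrable_schwartz_smul _) (H'.right.integrable_schwartz_smul _),
    H.integral_eq, H'.integral_eq]

theorem sub (H : FourierL2 f h) (H' : FourierL2 f' h') :
    FourierL2 (fun x => f x - f' x) (fun x => h x - h' x) := by
  refine ⟨H.left.sub H'.left, H.right.sub H'.right, fun φ => ?_⟩
  simp only [smul_sub]
  rw [integral_sub (H.left.integrable_schwartz_smul _) (H'.left.integrable_schwartz_smul _),
    integral_sub (H.right.integrable_schwartz_smul _) (H'.right.integrable_schwartz_smul _),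
    H.integral_eq, H'.integral_eq]

theorem zero : FourierL2 (fun _ : V => (0 : F)) (fun _ => 0) :=
  ⟨MemLp.zero', MemLp.zero', fun φ => by simp⟩

theorem sum {ι : Type*} (s : Finset ι) {f h : ι → V → F} (H : ∀ i, FourierL2 (f i) (h i)) :
    FourierL2 (fun x => ∑ i ∈ s, f i x) (fun x => ∑ i ∈ s, h i x) := by
  classical
  induction s using Finset.induction_on with
  | empty => simpa using zero
  | insert i s hi ih => simpa [Finset.sum_insert hi] using (H i).add ih

end FourierL2

theorem fourierL2_schwartz [CompleteSpace F] (ψ : 𝓢(V, F)) : FourierL2 ψ (𝓕 ψ : 𝓢(V, F)) :=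
  ⟨ψ.memLp 2 volume, (𝓕 ψ).memLp 2 volume, fun φ => SchwartzMap.integral_fourier_smul_eq φ ψ⟩

/-- Self-adjointness of the Fourier transform for integrable functions. -/
theorem integral_schwartz_fourier_smul_eq [CompleteSpace F] {f : V → F} (hf : Integrable f)
    (φ : 𝓢(V, ℂ)) : ∫ x, (𝓕 φ) x • f x = ∫ x, φ x • 𝓕 f x := by
  have := VectorFourier.integral_fourierIntegral_smul_eq_flip (L := innerₗ V)
    Real.continuous_fourierChar continuous_inner (φ.integrable (μ := volume)) hf
  simpa using! this

theorem continuous_fourier {f : V → F} (hf : Integrable f) :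
    Continuous (𝓕 f) :=
  VectorFourier.fourierIntegral_continuous Real.continuous_fourierChar continuous_inner hf

theorem continuous_fourierInv {f : V → F} (hf : Integrable f) :
    Continuous (𝓕⁻ f) := by
  have : 𝓕⁻ f = fun x => 𝓕 f (-x) := by
    ext x
    exact Real.fourierInv_eq_fourier_neg f x
  rw [this]
  exact (continuous_fourier hf).comp continuous_neg

theorem integral_schwartz_fourierInv_smul_eq [CompleteSpace F] {f : V → F} (hf : Integrable f)
    (φ : 𝓢(V, ℂ)) : ∫ x, (𝓕⁻ φ) x • f x = ∫ x, φ x • 𝓕⁻ f x := by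
  have := integral_schwartz_fourier_smul_eq hf.comp_neg φ
  rw [← integral_neg_eq_self] at this
  simp only [neg_neg] at this
  convert! this using 3 with x
  exact congrArg _ (congrFun (Real.fourierInv_eq_fourier_comp_neg f) _)

end FourierPairs

/-! ### Constant coefficient operators as Fourier multipliers -/

section Symbols

variable {d : ℕ} {F : Type*} [NormedAddCommGroup F] [InnerProductSpace ℂ F]

/-- The symbol `ξ ↦ p(2πiξ)` of the operator `p(∂)`. -/
noncomputable def symb (p : MvPolynomial (Fin d) ℂ) (ξ : EuclideanSpace ℝ (Fin d)) : ℂ :=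
  MvPolynomial.eval (fun i => 2 * Real.pi * Complex.I * (ξ i : ℂ)) p

section Lemmas

variable (p q : MvPolynomial (Fin d) ℂ) (ξ : EuclideanSpace ℝ (Fin d))

@[simp] theorem symb_C (a : ℂ) : symb (MvPolynomial.C a) ξ = a := by simp [symb]

@[simp] theorem symb_one : symb 1 ξ = 1 := by simp [symb]

@[simp] theorem symb_X (i : Fin d) :
    symb (MvPolynomial.X i) ξ = 2 * Real.pi * Complex.I * (ξ i : ℂ) := by simp [symb]

@[simp] theorem symb_neg : symb (-p) ξ = -symb p ξ := by simp [symb]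

@[simp] theorem symb_add : symb (p + q) ξ = symb p ξ + symb q ξ := by simp [symb]

@[simp] theorem symb_mul : symb (p * q) ξ = symb p ξ * symb q ξ := by simp [symb]

@[simp] theorem symb_pow (a : ℕ) : symb (p ^ a) ξ = symb p ξ ^ a := by simp [symb]

@[simp] theorem symb_sum {ι : Type*} (s : Finset ι) (f : ι → MvPolynomial (Fin d) ℂ) :
    symb (∑ i ∈ s, f i) ξ = ∑ i ∈ s, symb (f i) ξ := by simp [symb]

end Lemmas

theorem symb_hasTemperateGrowth (p : MvPolynomial (Fin d) ℂ) : (symb p).HasTemperateGrowth := by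
  have hc : ∀ i, (fun ξ : EuclideanSpace ℝ (Fin d) => (ξ i : ℂ)).HasTemperateGrowth := fun i =>
    (Complex.ofRealCLM.comp (EuclideanSpace.proj (𝕜 := ℝ) i)).hasTemperateGrowth
  induction p using MvPolynomial.induction_on with
  | C a => simp [funext (symb_C · a)]
  | add p q hp hq => simpa [funext (symb_add p q)] using! hp.add hq
  | mul_X p i hp =>
    have := hp.mul ((Function.HasTemperateGrowth.const (2 * Real.pi * Complex.I)).mul (hc i))
    convert! this using 1
    ext ξ
    simp

theorem continuous_symb (p : MvPolynomial (Fin d) ℂ) : Continuous (symb p) :=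
  (symb_hasTemperateGrowth p).1.continuous

theorem symb_transposeOp (p : MvPolynomial (Fin d) ℂ) (ξ : EuclideanSpace ℝ (Fin d)) :
    symb (transposeOp p) ξ = symb p (-ξ) := by
  rw [transposeOp]
  induction p using MvPolynomial.induction_on with
  | C a => simp
  | add p q hp hq => rw [map_add, symb_add, hp, hq, symb_add]
  | mul_X p i hp =>
    rw [map_mul, symb_mul, hp, MvPolynomial.aeval_X, symb_mul, symb_neg, symb_X, symb_X]
    simp

/-- Conjugation turns `2πiξ` into `-2πiξ`, and the transpose flips the sign back. -/
theorem symb_adjointOp (p : MvPolynomial (Fin d) ℂ) (ξ : EuclideanSpace ℝ (Fin d)) :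
    symb (adjointOp p) ξ = conj (symb p ξ) := by
  rw [adjointOp, symb_transposeOp]
  induction p using MvPolynomial.induction_on with
  | C a => simp
  | add p q hp hq => simp [hp, hq]
  | mul_X p i hp =>
    rw [map_mul, symb_mul, hp, MvPolynomial.map_X, symb_mul, symb_X, symb_X]
    simp only [map_mul, Complex.conj_I, Complex.conj_ofReal, PiLp.neg_apply, Complex.ofReal_neg,
      Complex.conj_ofNat]
    ring

theorem smulLeftCLM_mul_apply {g h : EuclideanSpace ℝ (Fin d) → ℂ} (hg : g.HasTemperateGrowth)
    (hh : h.HasTemperateGrowth) (χ : 𝓢(EuclideanSpace ℝ (Fin d), ℂ)) :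
    SchwartzMap.smulLeftCLM ℂ g (SchwartzMap.smulLeftCLM ℂ h χ) =
      SchwartzMap.smulLeftCLM ℂ (g * h) χ := by
  ext x
  simp [SchwartzMap.smulLeftCLM_apply_apply, hg, hh, hg.mul hh, mul_assoc]

theorem lineDerivOp_single_fourier (i : Fin d) (χ : 𝓢(EuclideanSpace ℝ (Fin d), ℂ)) :
    LineDeriv.lineDerivOpCLM ℂ 𝓢(EuclideanSpace ℝ (Fin d), ℂ)
        (EuclideanSpace.single i (1 : ℝ)) (𝓕 χ) =
      𝓕 (SchwartzMap.smulLeftCLM ℂ (symb (-MvPolynomial.X i)) χ) := by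
  rw [LineDeriv.lineDerivOpCLM_apply, SchwartzMap.lineDerivOp_fourier_eq]
  congr 1
  ext x
  have : (inner ℝ · (EuclideanSpace.single i (1 : ℝ)) :
    EuclideanSpace ℝ (Fin d) → ℝ).HasTemperateGrowth := by fun_prop
  simp only [SchwartzMap.smulLeftCLM_apply_apply, this, symb_hasTemperateGrowth, smul_apply]
  rw [EuclideanSpace.inner_single_right]
  simp [mul_assoc]

theorem lineDerivOp_single_pow_fourier (i : Fin d) (a : ℕ)
    (χ : 𝓢(EuclideanSpace ℝ (Fin d), ℂ)) :
    ((LineDeriv.lineDerivOpCLM ℂ 𝓢(EuclideanSpace ℝ (Fin d), ℂ)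
        (EuclideanSpace.single i (1 : ℝ))) ^ a) (𝓕 χ) =
      𝓕 (SchwartzMap.smulLeftCLM ℂ (symb ((-MvPolynomial.X i) ^ a)) χ) := by
  induction a generalizing χ with
  | zero =>
    have : symb 1 = fun _ : EuclideanSpace ℝ (Fin d) => (1 : ℂ) := funext symb_one
    simp [this]
  | succ a ih =>
    rw [pow_succ, mul_apply_eq_comp, lineDerivOp_single_fourier, ih,
      smulLeftCLM_mul_apply (symb_hasTemperateGrowth _) (symb_hasTemperateGrowth _)]
    congr 3
    ext x
    simp [pow_succ]

theorem list_prod_lineDerivOp_fourier (l : List (Fin d)) (α : Fin d → ℕ)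
    (χ : 𝓢(EuclideanSpace ℝ (Fin d), ℂ)) :
    ((l.map fun i => (LineDeriv.lineDerivOpCLM ℂ 𝓢(EuclideanSpace ℝ (Fin d), ℂ)
        (EuclideanSpace.single i (1 : ℝ))) ^ (α i)).prod) (𝓕 χ) =
      𝓕 (SchwartzMap.smulLeftCLM ℂ
        (symb ((l.map fun i => (-MvPolynomial.X i : MvPolynomial (Fin d) ℂ) ^ (α i)).prod)) χ) := by
  induction l generalizing χ with
  | nil =>
    have : symb 1 = fun _ : EuclideanSpace ℝ (Fin d) => (1 : ℂ) := funext symb_one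
    simp [this]
  | cons i l ih =>
    rw [List.map_cons, List.prod_cons, mul_apply_eq_comp, ih,
      lineDerivOp_single_pow_fourier,
      smulLeftCLM_mul_apply (symb_hasTemperateGrowth _) (symb_hasTemperateGrowth _)]
    congr 3
    ext x
    rw [List.map_cons, List.prod_cons, symb_mul, Pi.mul_apply]

/-- Each `∂_i` falling on `𝓕 χ` multiplies `χ` by `-2πi x_i`; the sign accounts for the transposed
symbol. -/
theorem diffOp_fourier (p : MvPolynomial (Fin d) ℂ) (χ : 𝓢(EuclideanSpace ℝ (Fin d), ℂ)) :
    diffOp p (𝓕 χ) = 𝓕 (SchwartzMap.smulLeftCLM ℂ (symb (transposeOp p)) χ) := by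
  have h : ∀ α : Fin d →₀ ℕ, (List.ofFn fun i : Fin d =>
      (LineDeriv.lineDerivOpCLM ℂ 𝓢(EuclideanSpace ℝ (Fin d), ℂ)
        (EuclideanSpace.single i (1 : ℝ))) ^ (α i)).prod (𝓕 χ) =
      𝓕 (SchwartzMap.smulLeftCLM ℂ
        (symb (∏ i, (-MvPolynomial.X i : MvPolynomial (Fin d) ℂ) ^ (α i))) χ) := fun α => by
    rw [List.ofFn_eq_map, list_prod_lineDerivOp_fourier, ← List.ofFn_eq_map, List.prod_ofFn]
  simp only [diffOp, h]
  simp only [← FourierTransform.fourier_smul]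
  rw [← FourierTransform.fourier_sum]
  congr 1
  ext x
  simp only [transposeOp, MvPolynomial.aeval_def, MvPolynomial.eval₂_eq']
  simp [SchwartzMap.smulLeftCLM_apply_apply, symb_hasTemperateGrowth, Finset.sum_mul, mul_assoc]

theorem diffOp_transposeOp_fourier (p : MvPolynomial (Fin d) ℂ)
    (χ : 𝓢(EuclideanSpace ℝ (Fin d), ℂ)) :
    diffOp (transposeOp p) (𝓕 χ) = 𝓕 (SchwartzMap.smulLeftCLM ℂ (symb p) χ) := by
  rw [diffOp_fourier]
  congr 3
  ext ξ
  rw [symb_transposeOp, symb_transposeOp, neg_neg]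

/-- The weak operator `p(∂)` is the multiplication by its symbol on the Fourier side. -/
theorem FourierL2.isWeakDiff_iff [CompleteSpace F] {p : MvPolynomial (Fin d) ℂ}
    {f h g : EuclideanSpace ℝ (Fin d) → F} (H : FourierL2 f h) :
    IsWeakDiff p f g ↔ FourierL2 g (fun ξ => symb p ξ • h ξ) := by
  have key : ∀ χ : 𝓢(EuclideanSpace ℝ (Fin d), ℂ),
      ∫ x, diffOp (transposeOp p) (𝓕 χ) x • f x = ∫ x, χ x • (symb p x • h x) := fun χ => by
    rw [diffOp_transposeOp_fourier, H.integral_eq]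
    simp [SchwartzMap.smulLeftCLM_apply_apply, symb_hasTemperateGrowth, smul_smul, mul_comm]
  constructor
  · rintro ⟨hg, hw⟩
    obtain ⟨k, hk⟩ := hg.exists_fourierL2
    refine hk.congr Filter.EventuallyEq.rfl ?_
    refine ae_eq_of_forall_integral_schwartz_smul_eq (hk.right.locallyIntegrable one_le_two)
      ?_ fun χ => ?_
    -- A continuous multiple of an `L²` function is locally integrable, which suffices before the
    -- product is known to be in `L²`.
    · rw [← locallyIntegrableOn_univ]
      exact (((H.right.locallyIntegrable one_le_two).locallyIntegrableOn _).continuousOn_smul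
        isOpen_univ.isLocallyClosed (continuous_symb p).continuousOn)
    · rw [← hk.integral_eq, ← hw, key]
  · intro Hg
    refine ⟨Hg.left, fun φ => ?_⟩
    have h1 := key (𝓕⁻ φ)
    have h2 := Hg.integral_eq (𝓕⁻ φ)
    rw [fourier_fourierInv_eq] at h1 h2
    rw [h1, h2]

/-- The (real) symbol of `ℓ`. -/
noncomputable def ellSymb (d k : ℕ) (c : ℕ → ℝ) (ξ : EuclideanSpace ℝ (Fin d)) : ℝ :=
  ∑ κ ∈ Finset.range (k + 1), c κ * (4 * Real.pi ^ 2 * ‖ξ‖ ^ 2) ^ κ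

theorem continuous_ellSymb (k : ℕ) (c : ℕ → ℝ) : Continuous (ellSymb d k c) := by
  unfold ellSymb; fun_prop

/-- Since `(2πi)² = -4π²`, the alternating signs in `ℓ` cancel. -/
theorem symb_ellPoly (k : ℕ) (c : ℕ → ℝ) (ξ : EuclideanSpace ℝ (Fin d)) :
    symb (ellPoly d k c) ξ = (ellSymb d k c ξ : ℂ) := by
  have h : ∀ κ : ℕ, symb ((∑ i, MvPolynomial.X i ^ 2) ^ κ) ξ =
      (-1) ^ κ * ((4 * Real.pi ^ 2 * ‖ξ‖ ^ 2) ^ κ : ℝ) := fun κ => by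
    rw [symb_pow, symb_sum, Complex.ofReal_pow, ← mul_pow, EuclideanSpace.norm_sq_eq]
    congr 1
    push_cast
    rw [Finset.mul_sum, Finset.mul_sum]
    refine Finset.sum_congr rfl fun i _ => ?_
    simp only [symb_pow, symb_X, mul_pow, Complex.I_sq, Real.norm_eq_abs]
    rw [← Complex.ofReal_pow |(_)|, sq_abs]
    push_cast
    ring
  simp only [ellPoly, ellSymb, symb_sum, symb_mul, symb_C, h]
  push_cast
  refine Finset.sum_congr rfl fun κ _ => ?_
  have : ((-1 : ℂ) ^ κ) * (-1) ^ κ = 1 := by rw [← mul_pow]; simp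
  linear_combination (c κ * (4 * Real.pi ^ 2 * ‖ξ‖ ^ 2) ^ κ : ℂ) * this

/-- Passing to symbols in `ℓ = P†P` makes `ellSymb` nonnegative and splits the energy density over
the `P_j`. -/
theorem ellSymb_eq_sum {r : ℕ} {k : ℕ} {c : ℕ → ℝ} {P : Fin r → MvPolynomial (Fin d) ℂ}
    (hP : IsFactorization k c P) (ξ : EuclideanSpace ℝ (Fin d)) :
    ellSymb d k c ξ = ∑ j, ‖symb (P j) ξ‖ ^ 2 := by
  have h := symb_ellPoly k c ξ
  rw [← hP] at h
  have h2 : ∀ j, symb (adjointOp (P j) * P j) ξ = ((‖symb (P j) ξ‖ ^ 2 : ℝ) : ℂ) := fun j => by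
    rw [symb_mul, symb_adjointOp, Complex.conj_mul']
    simp
  rw [symb_sum] at h
  simp only [h2] at h
  exact_mod_cast h.symm

/-- `ℓ` as an operator on Schwartz functions. -/
noncomputable def ellSchwartz (k : ℕ) (c : ℕ → ℝ) (ψ : 𝓢(EuclideanSpace ℝ (Fin d), F)) :
    𝓢(EuclideanSpace ℝ (Fin d), F) :=
  ∑ κ ∈ Finset.range (k + 1), ((-1) ^ κ * c κ) • (Δ^[κ] ψ)

theorem coe_iterate_laplacian (κ : ℕ) (ψ : 𝓢(EuclideanSpace ℝ (Fin d), F)) :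
    ⇑(Δ^[κ] ψ) = (Δ : (EuclideanSpace ℝ (Fin d) → F) → _)^[κ] ⇑ψ := by
  induction κ with
  | zero => rfl
  | succ κ ih =>
    rw [Function.iterate_succ_apply', Function.iterate_succ_apply', ← ih]
    ext x
    exact SchwartzMap.laplacian_apply _ x

theorem coe_ellSchwartz (k : ℕ) (c : ℕ → ℝ) (ψ : 𝓢(EuclideanSpace ℝ (Fin d), F)) :
    ⇑(ellSchwartz k c ψ) = ell k c ⇑ψ := by
  ext x
  simp [ellSchwartz, ell, ← coe_iterate_laplacian]

theorem fourier_laplacian_apply [CompleteSpace F] (ψ : 𝓢(EuclideanSpace ℝ (Fin d), F))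
    (ξ : EuclideanSpace ℝ (Fin d)) :
    (𝓕 (Δ ψ)) ξ = (-(4 * Real.pi ^ 2 * ‖ξ‖ ^ 2)) • (𝓕 ψ) ξ := by
  have hg : (fun x : EuclideanSpace ℝ (Fin d) => ‖x‖ ^ 2).HasTemperateGrowth := by fun_prop
  have h := SchwartzMap.laplacian_eq_fourierMultiplierCLM ψ
  have h2 := congrArg (fun φ : 𝓢(EuclideanSpace ℝ (Fin d), F) => (𝓕 φ) ξ) h
  simp only [SchwartzMap.fourierMultiplierCLM_apply] at h2
  rw [h2, FourierTransform.fourier_smul,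
    fourier_fourierInv_eq, smul_apply, SchwartzMap.smulLeftCLM_apply_apply hg, smul_smul]
  congr 1
  ring

theorem fourier_ellSchwartz_apply [CompleteSpace F] (k : ℕ) (c : ℕ → ℝ)
    (ψ : 𝓢(EuclideanSpace ℝ (Fin d), F)) (ξ : EuclideanSpace ℝ (Fin d)) :
    (𝓕 (ellSchwartz k c ψ)) ξ = ellSymb d k c ξ • (𝓕 ψ) ξ := by
  have hit : ∀ κ, (𝓕 (Δ^[κ] ψ)) ξ = (-(4 * Real.pi ^ 2 * ‖ξ‖ ^ 2)) ^ κ • (𝓕 ψ) ξ := fun κ => by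
    induction κ with
    | zero => simp
    | succ κ ih =>
      rw [Function.iterate_succ_apply', fourier_laplacian_apply, ih, smul_smul,
        pow_succ' _ κ]
  rw [ellSchwartz, FourierTransform.fourier_sum, sum_apply, ellSymb, Finset.sum_smul]
  refine Finset.sum_congr rfl fun κ _ => ?_
  rw [FourierTransform.fourier_smul, smul_apply, hit, smul_smul,
    neg_pow (4 * Real.pi ^ 2 * ‖ξ‖ ^ 2)]
  congr 1
  have : ((-1 : ℝ) ^ κ) * (-1) ^ κ = 1 := by rw [← mul_pow]; simp
  linear_combination (c κ * (4 * Real.pi ^ 2 * ‖ξ‖ ^ 2) ^ κ) * this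

theorem fourier_fourier_apply [CompleteSpace F] (ψ : 𝓢(EuclideanSpace ℝ (Fin d), F))
    (x : EuclideanSpace ℝ (Fin d)) : (𝓕 (𝓕 ψ)) x = ψ (-x) := by
  have h := FourierTransform.fourierInv_fourier_eq (F := 𝓢(EuclideanSpace ℝ (Fin d), F)) ψ
  rw [SchwartzMap.fourierInv_apply_eq] at h
  conv_rhs => rw [← h]
  simp

theorem ellSymb_neg (k : ℕ) (c : ℕ → ℝ) (ξ : EuclideanSpace ℝ (Fin d)) :
    ellSymb d k c (-ξ) = ellSymb d k c ξ := by
  simp [ellSymb]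

theorem ellSymb_hasTemperateGrowth (k : ℕ) (c : ℕ → ℝ) :
    (fun ξ => (ellSymb d k c ξ : ℂ)).HasTemperateGrowth := by
  simp only [← symb_ellPoly]
  exact symb_hasTemperateGrowth _

/-- On the Fourier side `ℓ` is the multiplication by its symbol. -/
theorem ell_fourier (k : ℕ) (c : ℕ → ℝ) (χ : 𝓢(EuclideanSpace ℝ (Fin d), ℂ)) :
    ell k c ⇑(𝓕 χ : 𝓢(EuclideanSpace ℝ (Fin d), ℂ)) =
      ⇑(𝓕 (SchwartzMap.smulLeftCLM ℂ (fun ξ => (ellSymb d k c ξ : ℂ)) χ) :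
        𝓢(EuclideanSpace ℝ (Fin d), ℂ)) := by
  rw [← coe_ellSchwartz]
  congr 1
  -- It suffices to compare transforms. The double transform is a reflection, under which the even
  -- symbol is invariant.
  apply (FourierTransform.fourierEquiv ℂ 𝓢(EuclideanSpace ℝ (Fin d), ℂ)).injective
  simp only [FourierTransform.fourierEquiv_apply]
  ext ξ
  rw [fourier_ellSchwartz_apply, fourier_fourier_apply, fourier_fourier_apply,
    SchwartzMap.smulLeftCLM_apply_apply (ellSymb_hasTemperateGrowth k c), ellSymb_neg]
  simp

/-- All derivatives fall on the test function, so `f` needs no smoothness. -/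
theorem FourierL2.integral_ell_smul {k : ℕ} {c : ℕ → ℝ}
    {f h : EuclideanSpace ℝ (Fin d) → F} (H : FourierL2 f h)
    (χ : 𝓢(EuclideanSpace ℝ (Fin d), ℂ)) :
    ∫ x, ell k c ⇑(𝓕 χ : 𝓢(EuclideanSpace ℝ (Fin d), ℂ)) x • f x =
      ∫ x, χ x • (ellSymb d k c x • h x) := by
  rw [ell_fourier, H.integral_eq]
  refine integral_congr_ae (.of_forall fun x => ?_)
  simp only [SchwartzMap.smulLeftCLM_apply_apply, ellSymb_hasTemperateGrowth, smul_eq_mul]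
  rw [mul_comm, mul_smul, Complex.coe_smul]

/-- Integration by parts for `ℓ`. -/
theorem integral_ell_smul_schwartz [CompleteSpace F] (k : ℕ) (c : ℕ → ℝ)
    (φ : 𝓢(EuclideanSpace ℝ (Fin d), ℂ)) (ψ : 𝓢(EuclideanSpace ℝ (Fin d), F)) :
    ∫ x, ell k c ⇑φ x • ψ x = ∫ x, φ x • ell k c ⇑ψ x := by
  have h1 := (fourierL2_schwartz ψ).integral_ell_smul (k := k) (c := c) (𝓕⁻ φ)
  have h2 := (fourierL2_schwartz (ellSchwartz k c ψ)).integral_eq (𝓕⁻ φ)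
  rw [fourier_fourierInv_eq] at h1 h2
  rw [h1, ← coe_ellSchwartz, h2]
  simp [fourier_ellSchwartz_apply]

end Symbols

/-! ### Fourier inversion and integrability of nonnegative transforms -/

section Integrable

variable {V F : Type*} [NormedAddCommGroup V] [InnerProductSpace ℝ V] [FiniteDimensional ℝ V]
  [MeasurableSpace V] [BorelSpace V] [NormedAddCommGroup F] [InnerProductSpace ℂ F]

theorem fourierL2_of_integrable [CompleteSpace F] {f : V → F} (hf : Integrable f)
    (h2 : MemLp (𝓕 f) 2 volume) :
    FourierL2 f (𝓕 f) := by
  obtain ⟨g, hg⟩ := h2.exists_fourierL2_symm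
  refine hg.congr ?_ EventuallyEq.rfl
  refine ae_eq_of_forall_integral_schwartz_smul_eq (hg.left.locallyIntegrable one_le_two)
    hf.locallyIntegrable fun φ => ?_
  have h1 := hg.integral_eq (𝓕⁻ φ)
  have h2 := integral_schwartz_fourier_smul_eq hf (𝓕⁻ φ)
  rw [fourier_fourierInv_eq] at h1 h2
  rw [h1, h2]

/-- Fourier inversion for a continuous square integrable function with an integrable Fourier
transform. -/
theorem FourierL2.eq_fourierInv [CompleteSpace F] {f h : V → F} (H : FourierL2 f h)
    (hf : Continuous f)
    (hh : Integrable h) : f = 𝓕⁻ h := by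
  refine (hf.ae_eq_iff_eq volume (continuous_fourierInv hh)).1 ?_
  refine ae_eq_of_forall_integral_schwartz_smul_eq (H.left.locallyIntegrable one_le_two)
    (continuous_fourierInv hh).locallyIntegrable fun φ => ?_
  have h1 := H.integral_eq (𝓕⁻ φ)
  rw [fourier_fourierInv_eq] at h1
  rw [h1, integral_schwartz_fourierInv_smul_eq hh]

theorem norm_fourier_le_integral_norm (f : V → F) (ξ : V) : ‖𝓕 f ξ‖ ≤ ∫ x, ‖f x‖ :=
  VectorFourier.norm_fourierIntegral_le_integral_norm _ _ _ _ _

theorem integrable_cexp_neg_inv_mul_sq_norm {c : ℝ} (hc : 0 < c) :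
    Integrable (fun w : V => Complex.exp (-c⁻¹ * ‖w‖ ^ 2)) := by
  simpa using GaussianFourier.integrable_cexp_neg_mul_sq_norm_add (V := V)
    (b := (c⁻¹ : ℂ)) (by simpa) 0 0

/-- The Gaussian means of the Fourier transform converge to the value at the origin. -/
theorem tendsto_integral_gaussian_fourier [CompleteSpace F] {f : V → F} (hf : Integrable f)
    (hf0 : ContinuousAt f 0) :
    Tendsto (fun c : ℝ => ∫ ξ, Complex.exp (-c⁻¹ * ‖ξ‖ ^ 2) • 𝓕 f ξ) atTop (𝓝 (f 0)) := by
  refine (Real.tendsto_integral_gaussian_smul' hf hf0).congr' ?_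
  filter_upwards [Ioi_mem_atTop 0] with c (hc : 0 < c)
  have h := VectorFourier.integral_fourierIntegral_smul_eq_flip (L := innerₗ V)
      Real.continuous_fourierChar continuous_inner
      (integrable_cexp_neg_inv_mul_sq_norm hc) hf
  have h' : ∫ ξ, 𝓕 (fun w : V => Complex.exp (-c⁻¹ * ‖w‖ ^ 2)) ξ • f ξ =
      ∫ ξ, Complex.exp (-c⁻¹ * ‖ξ‖ ^ 2) • 𝓕 f ξ := by
    simpa using! h
  rw [← h']
  congr with w
  rw [fourier_gaussian_innerProductSpace (by simpa)]
  congr 3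
  · simp
  · simp only [zero_sub, norm_neg, Complex.ofReal_inv, div_inv_eq_mul]
    ring

/-- A nonnegative Fourier transform of an integrable function that is continuous at the origin is
integrable. -/
theorem integrable_of_fourier_eq_nonneg {f : V → ℂ} {u : V → ℝ} (hf : Integrable f)
    (hf0 : ContinuousAt f 0) (hu : Continuous u) (hu0 : ∀ ξ, 0 ≤ u ξ)
    (h : ∀ ξ, 𝓕 f ξ = u ξ) : Integrable u := by
  refine ⟨hu.aestronglyMeasurable, ?_⟩
  rw [hasFiniteIntegral_iff_ofReal (.of_forall hu0)]
  have hbd : ∀ ξ, u ξ ≤ ∫ x, ‖f x‖ := fun ξ => by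
    have := norm_fourier_le_integral_norm f ξ
    rw [h] at this
    simpa [abs_of_nonneg (hu0 ξ)] using this
  -- `u` is bounded by the `L¹` norm of `f`, so a Gaussian weight makes it integrable.
  have hint : ∀ c : ℝ, 0 < c → Integrable (fun ξ => Real.exp (-c⁻¹ * ‖ξ‖ ^ 2) * u ξ) := by
    intro c hc
    have hJ : Integrable fun ξ : V => Real.exp (-c⁻¹ * ‖ξ‖ ^ 2) := by
      refine (integrable_cexp_neg_inv_mul_sq_norm (V := V) hc).norm.congr (.of_forall fun ξ => ?_)
      simp only [Complex.norm_exp]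
      congr 1
      norm_cast
    refine (hJ.mul_const (∫ x, ‖f x‖)).mono' (by fun_prop) (.of_forall fun ξ => ?_)
    rw [norm_mul, Real.norm_of_nonneg (Real.exp_nonneg _), Real.norm_of_nonneg (hu0 ξ)]
    gcongr
    exact hbd ξ
  set g : ℕ → V → ENNReal := fun n ξ => ENNReal.ofReal (Real.exp (-(n : ℝ)⁻¹ * ‖ξ‖ ^ 2) * u ξ)
  have hlim : ∀ ξ, Tendsto (fun n => g n ξ) atTop (𝓝 (ENNReal.ofReal (u ξ))) := fun ξ => by
    refine ENNReal.tendsto_ofReal ?_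
    have h1 : Tendsto (fun n : ℕ => Real.exp (-(n : ℝ)⁻¹ * ‖ξ‖ ^ 2) * u ξ) atTop
        (𝓝 (Real.exp (-0 * ‖ξ‖ ^ 2) * u ξ)) :=
      ((Real.continuous_exp.tendsto _).comp
        ((tendsto_inv_atTop_nhds_zero_nat (𝕜 := ℝ)).neg.mul_const _)).mul_const _
    simpa using h1
  -- Fatou's lemma: the weights tend to `1`, while the weighted integrals tend to the finite value
  -- `f 0`.
  calc ∫⁻ ξ, ENNReal.ofReal (u ξ) = ∫⁻ ξ, liminf (fun n => g n ξ) atTop :=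
        lintegral_congr fun ξ => (hlim ξ).liminf_eq.symm
    _ ≤ liminf (fun n => ∫⁻ ξ, g n ξ) atTop :=
        lintegral_liminf_le fun n => by fun_prop
    _ = ENNReal.ofReal (f 0).re := by
        refine Tendsto.liminf_eq ?_
        have h1 := ((Complex.continuous_re.tendsto _).comp
          (tendsto_integral_gaussian_fourier hf hf0)).comp tendsto_natCast_atTop_atTop
        refine (ENNReal.tendsto_ofReal h1).congr' ?_
        -- At `n = 0` the weight is `1`, because `0⁻¹ = 0`, and integrability is not yet available.
        filter_upwards [eventually_gt_atTop 0] with n hn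
        rw [← ofReal_integral_eq_lintegral_ofReal (hint n (by exact_mod_cast hn))
          (.of_forall fun ξ => mul_nonneg (Real.exp_nonneg _) (hu0 ξ))]
        congr 1
        rw [Function.comp_apply, Function.comp_apply, ← Complex.ofReal_re (∫ ξ, _),
          ← integral_complex_ofReal]
        congr 2 with ξ
        rw [h]
        push_cast
        simp
    _ < ⊤ := ENNReal.ofReal_lt_top

end Integrable

/-! ### The Fourier transform of the Green function -/

section Green

variable {d k r : ℕ} {c : ℕ → ℝ} {P : Fin r → MvPolynomial (Fin d) ℂ}
  {G : EuclideanSpace ℝ (Fin d) → ℝ}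
  {F : Type*} [NormedAddCommGroup F] [InnerProductSpace ℂ F]

/-- Testing `ℓ G = δ` on `𝓕 χ` gives `∫ χ m Ĝ = (𝓕 χ)(0) = ∫ χ`. Both `m Ĝ` and `1` are continuous,
so they agree everywhere. -/
theorem IsGreen.ellSymb_mul_fourier (hG : IsGreen k c G) (ξ : EuclideanSpace ℝ (Fin d)) :
    (ellSymb d k c ξ : ℂ) * 𝓕 (fun x => (G x : ℂ)) ξ = 1 := by
  have hi : Integrable (fun x => (G x : ℂ)) := hG.integrable.ofReal
  have hc1 : Continuous fun ξ => (ellSymb d k c ξ : ℂ) * 𝓕 (fun x => (G x : ℂ)) ξ :=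
    (Complex.continuous_ofReal.comp (continuous_ellSymb k c)).mul (continuous_fourier hi)
  have hc2 : Continuous fun _ : EuclideanSpace ℝ (Fin d) => (1 : ℂ) := continuous_const
  refine congrFun ((hc1.ae_eq_iff_eq volume hc2).1 ?_) ξ
  refine ae_eq_of_forall_integral_schwartz_smul_eq hc1.locallyIntegrable hc2.locallyIntegrable
    fun χ => ?_
  have h := hG.eq_delta (𝓕 χ)
  rw [ell_fourier] at h
  have h2 := integral_schwartz_fourier_smul_eq hi
    (SchwartzMap.smulLeftCLM ℂ (fun ξ => (ellSymb d k c ξ : ℂ)) χ)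
  have h3 : (𝓕 χ) 0 = ∫ x, χ x := by
    rw [SchwartzMap.fourier_coe, Real.fourier_eq]
    simp
  simp only [smul_eq_mul, mul_one]
  rw [← h3, ← h]
  calc _ = ∫ x, (SchwartzMap.smulLeftCLM ℂ (fun ξ => (ellSymb d k c ξ : ℂ)) χ) x •
        𝓕 (fun x => (G x : ℂ)) x := by
        refine integral_congr_ae (.of_forall fun x => ?_)
        simp only [SchwartzMap.smulLeftCLM_apply_apply, ellSymb_hasTemperateGrowth, smul_eq_mul]
        ring
    _ = _ := by
        rw [← h2]
        refine integral_congr_ae (.of_forall fun x => ?_)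
        simp [mul_comm]

theorem ellSymb_pos (hP : IsFactorization k c P) (hG : IsGreen k c G)
    (ξ : EuclideanSpace ℝ (Fin d)) : 0 < ellSymb d k c ξ := by
  refine lt_of_le_of_ne ?_ fun h => ?_
  · rw [ellSymb_eq_sum hP]; positivity
  · have := hG.ellSymb_mul_fourier ξ
    simp [← h] at this

theorem IsGreen.fourier_eq (hG : IsGreen k c G) (ξ : EuclideanSpace ℝ (Fin d)) :
    𝓕 (fun x => (G x : ℂ)) ξ = ((ellSymb d k c ξ)⁻¹ : ℝ) := by
  rw [Complex.ofReal_inv]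
  exact eq_inv_of_mul_eq_one_right (hG.ellSymb_mul_fourier ξ)

theorem IsGreen.integral_pos (hG : IsGreen k c G) (hP : IsFactorization k c P) :
    0 < ∫ x, G x := by
  have h := hG.fourier_eq 0
  rw [Real.fourier_eq] at h
  simp only [inner_zero_right, neg_zero, AddChar.map_zero_eq_one, one_smul] at h
  rw [integral_complex_ofReal] at h
  rw [Complex.ofReal_injective h]
  exact inv_pos.2 (ellSymb_pos hP hG 0)

theorem continuous_inv_ellSymb (hP : IsFactorization k c P) (hG : IsGreen k c G) :
    Continuous fun ξ => (ellSymb d k c ξ)⁻¹ :=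
  (continuous_ellSymb k c).inv₀ fun ξ => (ellSymb_pos hP hG ξ).ne'

/-- This turns continuity of `G` at the origin into the Sobolev-type condition that makes point
evaluation bounded for the energy. -/
theorem integrable_inv_ellSymb (hP : IsFactorization k c P) (hG : IsGreen k c G) :
    Integrable fun ξ => (ellSymb d k c ξ)⁻¹ :=
  integrable_of_fourier_eq_nonneg hG.integrable.ofReal
    (Complex.continuous_ofReal.comp hG.continuous).continuousAt (continuous_inv_ellSymb hP hG)
    (fun ξ => (inv_pos.2 (ellSymb_pos hP hG ξ)).le) hG.fourier_eq

/-- The Fourier transform of the translated Green function `G(· - z) w`. -/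
noncomputable def greenFourier (k : ℕ) (c : ℕ → ℝ) (z : EuclideanSpace ℝ (Fin d)) (w : F)
    (ξ : EuclideanSpace ℝ (Fin d)) : F :=
  (ellSymb d k c ξ)⁻¹ • (Real.fourierChar (-inner ℝ z ξ) • w)

theorem norm_greenFourier (hP : IsFactorization k c P) (hG : IsGreen k c G)
    (z : EuclideanSpace ℝ (Fin d)) (w : F) (ξ : EuclideanSpace ℝ (Fin d)) :
    ‖greenFourier k c z w ξ‖ = (ellSymb d k c ξ)⁻¹ * ‖w‖ := by
  rw [greenFourier, norm_smul, Circle.norm_smul, Real.norm_eq_abs,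
    abs_of_pos (inv_pos.2 (ellSymb_pos hP hG ξ))]

theorem continuous_greenFourier (hP : IsFactorization k c P) (hG : IsGreen k c G)
    (z : EuclideanSpace ℝ (Fin d)) (w : F) : Continuous (greenFourier k c z w) := by
  have h1 := continuous_inv_ellSymb hP hG
  have h2 := Real.continuous_fourierChar
  unfold greenFourier
  fun_prop

theorem integrable_greenFourier (hP : IsFactorization k c P) (hG : IsGreen k c G)
    (z : EuclideanSpace ℝ (Fin d)) (w : F) : Integrable (greenFourier k c z w) := by
  refine ((integrable_inv_ellSymb hP hG).mul_const ‖w‖).mono'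
    (continuous_greenFourier hP hG z w).aestronglyMeasurable (.of_forall fun ξ => ?_)
  rw [norm_greenFourier hP hG]

theorem fourierL2_green [CompleteSpace F] (hP : IsFactorization k c P) (hG : IsGreen k c G)
    (z : EuclideanSpace ℝ (Fin d)) (w : F) :
    FourierL2 (fun x => G (x - z) • w) (greenFourier k c z w) := by
  have hint : Integrable (fun x => G (x - z) • w) := (hG.integrable.comp_sub_right z).smul_const w
  have hf : 𝓕 (fun x => G (x - z) • w) = greenFourier k c z w := by
    ext ξ
    have h1 : 𝓕 (fun x => G x • w) ξ = (ellSymb d k c ξ)⁻¹ • w := by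
      have h2 := hG.fourier_eq ξ
      rw [Real.fourier_eq] at h2 ⊢
      rw [← Complex.coe_smul, ← h2, ← integral_smul_const]
      refine integral_congr_ae (.of_forall fun x => ?_)
      simp only [Circle.smul_def, smul_eq_mul, mul_smul, Complex.coe_smul]
    have h3 := VectorFourier.fourierIntegral_comp_add_right Real.fourierChar
      (volume : Measure (EuclideanSpace ℝ (Fin d))) (innerₗ (EuclideanSpace ℝ (Fin d)))
      (fun x => G x • w) (-z)
    have h4 := congrFun h3 ξ
    have h5 : 𝓕 (fun x => G (x - z) • w) ξ =
        Real.fourierChar (-inner ℝ z ξ) • 𝓕 (fun x => G x • w) ξ := by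
      simpa [sub_eq_add_neg] using! h4
    rw [h5, h1, greenFourier, smul_comm]
  rw [← hf]
  refine fourierL2_of_integrable hint ?_
  rw [hf, memLp_two_iff_integrable_sq_norm (continuous_greenFourier hP hG z w).aestronglyMeasurable]
  -- One factor of `m⁻²` is bounded by the `L¹` norm of `G`, since `m⁻¹ = Ĝ`; the other is
  -- integrable.
  refine ((integrable_inv_ellSymb hP hG).mul_const ((∫ x, ‖(G x : ℂ)‖) * ‖w‖ ^ 2)).mono'
    ((continuous_greenFourier hP hG z w).norm.pow 2).aestronglyMeasurable (.of_forall fun ξ => ?_)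
  have hb : (ellSymb d k c ξ)⁻¹ ≤ ∫ x, ‖(G x : ℂ)‖ := by
    have := norm_fourier_le_integral_norm (fun x => (G x : ℂ)) ξ
    rw [hG.fourier_eq] at this
    exact (le_abs_self _).trans (by simpa using this)
  have hpos := inv_pos.2 (ellSymb_pos hP hG ξ)
  rw [norm_greenFourier hP hG, norm_pow, norm_mul, Real.norm_of_nonneg hpos.le, norm_norm, mul_pow,
    sq (ellSymb d k c ξ)⁻¹, mul_assoc]
  gcongr

end Green

/-! ### The energy space and its reproducing kernel -/

section Energy

variable {d k r : ℕ} {c : ℕ → ℝ} {P : Fin r → MvPolynomial (Fin d) ℂ}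
  {G : EuclideanSpace ℝ (Fin d) → ℝ}
  {F : Type*} [NormedAddCommGroup F] [InnerProductSpace ℂ F]

theorem aestronglyMeasurable_symb_smul {h : EuclideanSpace ℝ (Fin d) → F}
    (hh : AEStronglyMeasurable h) (p : MvPolynomial (Fin d) ℂ) :
    AEStronglyMeasurable fun ξ => symb p ξ • h ξ :=
  (continuous_symb p).aestronglyMeasurable.smul hh

theorem ellSymb_mul_norm_sq (hP : IsFactorization k c P) (h : EuclideanSpace ℝ (Fin d) → F)
    (ξ : EuclideanSpace ℝ (Fin d)) :
    ellSymb d k c ξ * ‖h ξ‖ ^ 2 = ∑ j, ‖symb (P j) ξ • h ξ‖ ^ 2 := by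
  simp only [ellSymb_eq_sum hP, Finset.sum_mul, norm_smul, mul_pow]

theorem integrable_ellSymb_mul_norm_sq_iff (hP : IsFactorization k c P)
    {h : EuclideanSpace ℝ (Fin d) → F} (hh : AEStronglyMeasurable h) :
    Integrable (fun ξ => ellSymb d k c ξ * ‖h ξ‖ ^ 2) ↔
      ∀ j, MemLp (fun ξ => symb (P j) ξ • h ξ) 2 volume := by
  have hm := fun j => aestronglyMeasurable_symb_smul hh (P j)
  simp only [fun j => memLp_two_iff_integrable_sq_norm (hm j), ellSymb_mul_norm_sq hP]
  refine ⟨fun H j => H.mono' ((hm j).norm.pow 2) (.of_forall fun ξ => ?_),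
    fun H => integrable_finsetSum _ fun j _ => H j⟩
  rw [Real.norm_of_nonneg (by positivity)]
  exact Finset.single_le_sum (f := fun j => ‖symb (P j) ξ • h ξ‖ ^ 2)
    (fun _ _ => by positivity) (Finset.mem_univ j)

/-- Weak derivatives in `L²` correspond to `symb (P j) • h` in `L²`, and the squares add up to `m
‖h‖²`. -/
theorem FourierL2.admissible_iff [CompleteSpace F] (hP : IsFactorization k c P)
    {f h : EuclideanSpace ℝ (Fin d) → F} (H : FourierL2 f h) :
    Admissible P f ↔ Continuous f ∧ Integrable (fun ξ => ellSymb d k c ξ * ‖h ξ‖ ^ 2) := by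
  rw [integrable_ellSymb_mul_norm_sq_iff hP H.right.1, Admissible]
  simp only [H.isWeakDiff_iff]
  refine and_congr_right fun _ => ⟨fun h j => (h.2 j).elim fun g hg => hg.right,
    fun h => ⟨H.left, fun j => (h j).exists_fourierL2_symm⟩⟩

/-- Plancherel for each component; the representative chosen by `weakDiff` is immaterial. -/
theorem FourierL2.energy_eq [CompleteSpace F] (hP : IsFactorization k c P)
    {f h : EuclideanSpace ℝ (Fin d) → F} (H : FourierL2 f h) (hf : Admissible P f) :
    energy P f = ∫ ξ, ellSymb d k c ξ * ‖h ξ‖ ^ 2 := by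
  have hw : ∀ j, FourierL2 (weakDiff (P j) f) (fun ξ => symb (P j) ξ • h ξ) := fun j => by
    rw [← H.isWeakDiff_iff, weakDiff, dif_pos (hf.2.2 j)]
    exact (hf.2.2 j).choose_spec
  simp only [ellSymb_mul_norm_sq hP, energy]
  rw [integral_finsetSum _ fun j _ =>
    (memLp_two_iff_integrable_sq_norm (hw j).right.1).1 (hw j).right]
  exact Finset.sum_congr rfl fun j _ => (hw j).integral_norm_sq

theorem integrable_ellSymb_mul_norm_sub_sq (hP : IsFactorization k c P)
    {a b : EuclideanSpace ℝ (Fin d) → F} (ha' : AEStronglyMeasurable a)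
    (hb' : AEStronglyMeasurable b)
    (ha : Integrable (fun ξ => ellSymb d k c ξ * ‖a ξ‖ ^ 2))
    (hb : Integrable (fun ξ => ellSymb d k c ξ * ‖b ξ‖ ^ 2)) :
    Integrable (fun ξ => ellSymb d k c ξ * ‖a ξ - b ξ‖ ^ 2) := by
  rw [integrable_ellSymb_mul_norm_sq_iff hP ha'] at ha
  rw [integrable_ellSymb_mul_norm_sq_iff hP hb'] at hb
  refine (integrable_ellSymb_mul_norm_sq_iff hP (ha'.sub hb')).2 fun j => ?_
  simpa only [Pi.sub_apply, smul_sub] using! (ha j).sub (hb j)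

/-- A square integrable Fourier transform of finite energy is integrable. -/
theorem integrable_of_integrable_energy {F : Type*} [NormedAddCommGroup F]
    (hP : IsFactorization k c P) (hG : IsGreen k c G)
    {h : EuclideanSpace ℝ (Fin d) → F} (hh : AEStronglyMeasurable h)
    (he : Integrable (fun ξ => ellSymb d k c ξ * ‖h ξ‖ ^ 2)) : Integrable h := by
  -- The majorant comes from `2‖h‖ ≤ m⁻¹ + m‖h‖²`, that is, `m (m⁻¹ - ‖h‖)² ≥ 0`.
  refine ((integrable_inv_ellSymb hP hG).add he).mono' hh (.of_forall fun ξ => ?_)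
  have hm := ellSymb_pos hP hG ξ
  have hm' := inv_pos.2 hm
  have h1 : ellSymb d k c ξ * (ellSymb d k c ξ)⁻¹ = 1 := mul_inv_cancel₀ hm.ne'
  simp only [Pi.add_apply]
  have h2 : (ellSymb d k c ξ)⁻¹ + ellSymb d k c ξ * ‖h ξ‖ ^ 2 - 2 * ‖h ξ‖ =
      ellSymb d k c ξ * ((ellSymb d k c ξ)⁻¹ - ‖h ξ‖) ^ 2 := by
    linear_combination (2 * ‖h ξ‖ - (ellSymb d k c ξ)⁻¹) * h1
  have h3 : 0 ≤ ellSymb d k c ξ * ((ellSymb d k c ξ)⁻¹ - ‖h ξ‖) ^ 2 := by positivity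
  linarith [norm_nonneg (h ξ)]

theorem inner_fourierChar_smul (w u : F) (t : ℝ) :
    inner ℂ (Real.fourierChar (-t) • w) u = inner ℂ w (Real.fourierChar t • u) := by
  rw [Circle.smul_def, Circle.smul_def, inner_smul_left, inner_smul_right, AddChar.map_neg_eq_inv,
    ← Circle.coe_inv_eq_conj, inv_inv]

theorem integrable_inner_of_memLp {f g : EuclideanSpace ℝ (Fin d) → F} (hf : MemLp f 2 volume)
    (hg : MemLp g 2 volume) : Integrable fun x => inner ℂ (f x) (g x) := by
  have h := L2.integrable_inner (𝕜 := ℂ) (hf.toLp f) (hg.toLp g)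
  refine h.congr ?_
  filter_upwards [hf.coeFn_toLp, hg.coeFn_toLp] with x hx hx'
  rw [hx, hx']

/-- The values of `𝓕⁻ u` as integrals. -/
theorem integral_inner_fourierChar_smul [CompleteSpace F] {u : EuclideanSpace ℝ (Fin d) → F}
    (hu : Integrable u) (z : EuclideanSpace ℝ (Fin d)) (w : F) :
    Integrable (fun ξ => inner ℂ (Real.fourierChar (-inner ℝ z ξ) • w) (u ξ)) ∧
      ∫ ξ, inner ℂ (Real.fourierChar (-inner ℝ z ξ) • w) (u ξ) = inner ℂ w (𝓕⁻ u z) := by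
  simp only [inner_fourierChar_smul]
  have hi : Integrable (fun ξ => Real.fourierChar (inner ℝ z ξ) • u ξ) := by
    have hc : Continuous fun ξ : EuclideanSpace ℝ (Fin d) => Real.fourierChar (inner ℝ z ξ) :=
      Real.continuous_fourierChar.comp (by fun_prop)
    refine hu.norm.mono' (hc.aestronglyMeasurable.smul hu.1) (.of_forall fun ξ => ?_)
    rw [Circle.norm_smul]
  refine ⟨hi.const_inner w, ?_⟩
  rw [integral_inner hi, Real.fourierInv_eq]
  simp only [real_inner_comm]

variable {ι : Type*} [Fintype ι]

/-- The smooth function `B` plus a combination of translated Green functions. -/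
noncomputable def kernelExpansion (G : EuclideanSpace ℝ (Fin d) → ℝ)
    (B : 𝓢(EuclideanSpace ℝ (Fin d), F)) (xs : ι → EuclideanSpace ℝ (Fin d)) (w : ι → F)
    (x : EuclideanSpace ℝ (Fin d)) : F :=
  B x + ∑ i, G (x - xs i) • w i

/-- The Fourier transform of a kernel expansion. -/
noncomputable def kernelFourier (k : ℕ) (c : ℕ → ℝ)
    (B : 𝓢(EuclideanSpace ℝ (Fin d), F)) (xs : ι → EuclideanSpace ℝ (Fin d)) (w : ι → F)
    (ξ : EuclideanSpace ℝ (Fin d)) : F :=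
  (𝓕 B) ξ + ∑ i, greenFourier k c (xs i) (w i) ξ

variable (B : 𝓢(EuclideanSpace ℝ (Fin d), F)) (xs : ι → EuclideanSpace ℝ (Fin d)) (w : ι → F)

theorem fourierL2_kernelExpansion [CompleteSpace F] (hP : IsFactorization k c P)
    (hG : IsGreen k c G) :
    FourierL2 (kernelExpansion G B xs w) (kernelFourier k c B xs w) :=
  (fourierL2_schwartz B).add
    (FourierL2.sum Finset.univ fun i => fourierL2_green hP hG (xs i) (w i))

theorem ellSymb_smul_kernelFourier [CompleteSpace F] (hP : IsFactorization k c P)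
    (hG : IsGreen k c G) (ξ : EuclideanSpace ℝ (Fin d)) :
    ellSymb d k c ξ • kernelFourier k c B xs w ξ =
      (𝓕 (ellSchwartz k c B)) ξ + ∑ i, Real.fourierChar (-inner ℝ (xs i) ξ) • w i := by
  rw [kernelFourier, smul_add, Finset.smul_sum, fourier_ellSchwartz_apply]
  simp only [greenFourier, smul_inv_smul₀ (ellSymb_pos hP hG ξ).ne']

/-- Write `m‖h‖² = ‖m h‖ ‖h‖`: the factor `m h` is a Schwartz function plus characters, hence
bounded, and `h` is integrable. -/
theorem integrable_energy_kernelFourier [CompleteSpace F] (hP : IsFactorization k c P)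
    (hG : IsGreen k c G) :
    Integrable fun ξ => ellSymb d k c ξ * ‖kernelFourier k c B xs w ξ‖ ^ 2 := by
  have hi : Integrable (kernelFourier k c B xs w) :=
    ((𝓕 B).integrable).add (integrable_finsetSum _ fun i _ =>
      integrable_greenFourier hP hG (xs i) (w i))
  obtain ⟨C, hC⟩ : ∃ C, ∀ ξ, ‖(𝓕 (ellSchwartz k c B)) ξ‖ ≤ C :=
    ⟨_, fun ξ => SchwartzMap.norm_le_seminorm ℝ _ ξ⟩
  refine (hi.norm.const_mul (C + ∑ i, ‖w i‖)).mono'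
    ((continuous_ellSymb k c).aestronglyMeasurable.mul (hi.1.norm.pow 2)) (.of_forall fun ξ => ?_)
  have hm := ellSymb_pos hP hG ξ
  rw [Real.norm_of_nonneg (by positivity), sq, ← mul_assoc]
  gcongr
  rw [← Real.norm_of_nonneg hm.le, ← norm_smul, ellSymb_smul_kernelFourier B xs w hP hG]
  refine (norm_add_le _ _).trans (add_le_add (hC ξ) ((norm_sum_le _ _).trans ?_))
  simp [Circle.norm_smul]

theorem continuous_kernelExpansion (hG : IsGreen k c G) :
    Continuous (kernelExpansion G B xs w) := by
  have := hG.continuous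
  have := B.continuous
  unfold kernelExpansion
  fun_prop

theorem admissible_kernelExpansion [CompleteSpace F] (hP : IsFactorization k c P)
    (hG : IsGreen k c G) : Admissible P (kernelExpansion G B xs w) :=
  ((fourierL2_kernelExpansion B xs w hP hG).admissible_iff hP).2
    ⟨continuous_kernelExpansion B xs w hG, integrable_energy_kernelFourier B xs w hP hG⟩

/-- The energy inner product with a kernel expansion: the reproducing property of the Green
function. -/
theorem integral_inner_kernelFourier [CompleteSpace F] (hP : IsFactorization k c P)
    (hG : IsGreen k c G) {v u : EuclideanSpace ℝ (Fin d) → F} (H : FourierL2 v u)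
    (hv : Continuous v) (hu : Integrable u) :
    Integrable (fun ξ => inner ℂ (ellSymb d k c ξ • kernelFourier k c B xs w ξ) (u ξ)) ∧
    ∫ ξ, inner ℂ (ellSymb d k c ξ • kernelFourier k c B xs w ξ) (u ξ) =
      (∫ x, inner ℂ (ellSchwartz k c B x) (v x)) + ∑ i, inner ℂ (w i) (v (xs i)) := by
  have h1 := fun i => integral_inner_fourierChar_smul hu (xs i) (w i)
  have h2 := (fourierL2_schwartz (ellSchwartz k c B)).integral_inner H
  have h3 : Integrable fun ξ => inner ℂ ((𝓕 (ellSchwartz k c B)) ξ) (u ξ) :=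
    integrable_inner_of_memLp ((𝓕 (ellSchwartz k c B)).memLp 2 volume) H.right
  -- Inversion holds at every point, so the characters evaluate `v` itself at the `xs i`.
  rw [← H.eq_fourierInv hv hu] at h1
  simp only [ellSymb_smul_kernelFourier B xs w hP hG, inner_add_left, sum_inner]
  refine ⟨h3.add (integrable_finsetSum _ fun i _ => (h1 i).1), ?_⟩
  rw [integral_add h3 (integrable_finsetSum _ fun i _ => (h1 i).1), h2,
    integral_finsetSum _ fun i _ => (h1 i).1]
  simp only [(h1 _).2]

theorem Admissible.sub [CompleteSpace F] (hP : IsFactorization k c P)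
    {f g : EuclideanSpace ℝ (Fin d) → F} (hf : Admissible P f) (hg : Admissible P g) :
    Admissible P fun x => f x - g x := by
  obtain ⟨h, H⟩ := hf.2.1.exists_fourierL2
  obtain ⟨h', H'⟩ := hg.2.1.exists_fourierL2
  rw [H.admissible_iff hP] at hf
  rw [H'.admissible_iff hP] at hg
  exact ((H.sub H').admissible_iff hP).2 ⟨hf.1.sub hg.1,
    integrable_ellSymb_mul_norm_sub_sq hP H.right.1 H'.right.1 hf.2 hg.2⟩

/-- Expansion of the energy around a kernel expansion. -/
theorem energy_eq_add_energy_sub [CompleteSpace F] (hP : IsFactorization k c P)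
    (hG : IsGreen k c G) {g : EuclideanSpace ℝ (Fin d) → F} (hg : Admissible P g) :
    energy P g = energy P (kernelExpansion G B xs w) +
      energy P (fun x => g x - kernelExpansion G B xs w x) +
      2 * ((∫ x, inner ℂ (ellSchwartz k c B x) (g x - kernelExpansion G B xs w x)) +
        ∑ i, inner ℂ (w i) (g (xs i) - kernelExpansion G B xs w (xs i))).re := by
  obtain ⟨h, H⟩ := hg.2.1.exists_fourierL2
  have H0 := fourierL2_kernelExpansion B xs w hP hG
  have hf := admissible_kernelExpansion B xs w hP hG
  have hv := hg.sub hP hf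
  have Hv := H.sub H0
  have hev := ((Hv.admissible_iff hP).1 hv).2
  have hu := integrable_of_integrable_energy hP hG Hv.right.1 hev
  have hcross := integral_inner_kernelFourier B xs w hP hG Hv hv.1 hu
  have hsum : Integrable fun ξ => ellSymb d k c ξ * ‖kernelFourier k c B xs w ξ‖ ^ 2 +
      ellSymb d k c ξ * ‖h ξ - kernelFourier k c B xs w ξ‖ ^ 2 :=
    (integrable_energy_kernelFourier B xs w hP hG).add hev
  rw [← hcross.2, H.energy_eq hP hg, H0.energy_eq hP hf, Hv.energy_eq hP hv,
    ← RCLike.re_eq_complex_re, ← integral_re hcross.1, ← integral_const_mul,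
    ← integral_add (integrable_energy_kernelFourier B xs w hP hG) hev,
    ← integral_add hsum (hcross.1.re.const_mul 2)]
  refine integral_congr_ae (.of_forall fun ξ => ?_)
  have := norm_add_sq (𝕜 := ℂ) (kernelFourier k c B xs w ξ) (h ξ - kernelFourier k c B xs w ξ)
  simp only [add_sub_cancel] at this ⊢
  rw [this, ← Complex.coe_smul, inner_smul_left, Complex.conj_ofReal, RCLike.re_eq_complex_re,
    Complex.re_ofReal_mul]
  ring

theorem energy_nonneg (f : EuclideanSpace ℝ (Fin d) → F) : 0 ≤ energy P f :=
  Finset.sum_nonneg fun _ _ => integral_nonneg fun _ => by positivity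

/-- Positivity of the symbol kills the transform almost everywhere, and continuity removes the
exceptional set. -/
theorem Admissible.eq_zero_of_energy_eq_zero [CompleteSpace F] (hP : IsFactorization k c P)
    (hG : IsGreen k c G) {f : EuclideanSpace ℝ (Fin d) → F} (hf : Admissible P f)
    (h0 : energy P f = 0) : f = 0 := by
  obtain ⟨h, H⟩ := hf.2.1.exists_fourierL2
  rw [H.energy_eq hP hf, integral_eq_zero_iff_of_nonneg
    (fun ξ => mul_nonneg (ellSymb_pos hP hG ξ).le (by positivity))
    ((H.admissible_iff hP).1 hf).2] at h0
  have h1 : h =ᵐ[volume] fun _ => 0 := by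
    filter_upwards [h0] with ξ hξ
    simpa [(ellSymb_pos hP hG ξ).ne'] using hξ
  exact (hf.1.ae_eq_iff_eq volume continuous_const).1 (H.unique_left FourierL2.zero h1)

/-- A continuous square integrable solution of `ℓ f = 0` vanishes. -/
theorem eq_zero_of_forall_integral_ell_smul_eq_zero [CompleteSpace F] (hP : IsFactorization k c P)
    (hG : IsGreen k c G) {f : EuclideanSpace ℝ (Fin d) → F} (hf : Continuous f)
    (hf2 : MemLp f 2 volume)
    (h0 : ∀ φ : 𝓢(EuclideanSpace ℝ (Fin d), ℂ), ∫ x, ell k c (⇑φ) x • f x = 0) : f = 0 := by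
  obtain ⟨h, H⟩ := hf2.exists_fourierL2
  have h1 : (fun ξ => ellSymb d k c ξ • h ξ) =ᵐ[volume] fun _ => 0 := by
    refine ae_eq_of_forall_integral_schwartz_smul_eq ?_ continuous_const.locallyIntegrable
      fun χ => ?_
    · rw [← locallyIntegrableOn_univ]
      exact ((H.right.locallyIntegrable one_le_two).locallyIntegrableOn _).continuousOn_smul
        isOpen_univ.isLocallyClosed (continuous_ellSymb k c).continuousOn
    · rw [← H.integral_ell_smul, h0]
      simp
  have h2 : h =ᵐ[volume] fun _ => 0 := by
    filter_upwards [h1] with ξ hξ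
    simpa [(ellSymb_pos hP hG ξ).ne'] using hξ
  exact (hf.ae_eq_iff_eq volume continuous_const).1 (H.unique_left FourierL2.zero h2)

/-- The distributional equation of a kernel expansion. -/
theorem integral_ell_smul_kernelExpansion [CompleteSpace F] (hP : IsFactorization k c P)
    (hG : IsGreen k c G) (φ : 𝓢(EuclideanSpace ℝ (Fin d), ℂ)) :
    ∫ x, ell k c (⇑φ) x • kernelExpansion G B xs w x =
      (∫ x, φ x • ell k c (⇑B) x) + ∑ i, φ (xs i) • w i := by
  have h1 := (fourierL2_kernelExpansion B xs w hP hG).integral_ell_smul (k := k) (c := c) (𝓕⁻ φ)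
  have h2 := (fourierL2_schwartz (ellSchwartz k c B)).integral_eq (𝓕⁻ φ)
  rw [fourier_fourierInv_eq] at h1 h2
  simp only [ellSymb_smul_kernelFourier B xs w hP hG, smul_add, Finset.smul_sum] at h1
  have hi : ∀ i, Integrable fun ξ => (𝓕⁻ φ) ξ • (Real.fourierChar (-inner ℝ (xs i) ξ) • w i) := by
    intro i
    have hc : Continuous fun ξ : EuclideanSpace ℝ (Fin d) =>
        Real.fourierChar (-inner ℝ (xs i) ξ) • w i :=
      (Real.continuous_fourierChar.comp (by fun_prop)).smul continuous_const
    refine ((𝓕⁻ φ).integrable (μ := volume) |>.norm.mul_const ‖w i‖).mono'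
      ((𝓕⁻ φ).continuous.smul hc).aestronglyMeasurable (.of_forall fun ξ => ?_)
    rw [norm_smul, Circle.norm_smul]
  have hval : ∀ i, ∫ ξ, (𝓕⁻ φ) ξ • (Real.fourierChar (-inner ℝ (xs i) ξ) • w i) =
      φ (xs i) • w i := by
    intro i
    have h3 : φ (xs i) = (𝓕 (𝓕⁻ φ)) (xs i) := by rw [fourier_fourierInv_eq]
    rw [h3, SchwartzMap.fourier_coe, Real.fourier_eq, ← integral_smul_const]
    refine integral_congr_ae (.of_forall fun ξ => ?_)
    simp only [real_inner_comm ξ (xs i), Circle.smul_def, smul_smul, smul_eq_mul]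
    rw [mul_comm]
  rw [h1, integral_add ((𝓕 (ellSchwartz k c B)).memLp 2 volume |>.integrable_schwartz_smul _)
    (integrable_finsetSum _ fun i _ => hi i), integral_finsetSum _ fun i _ => hi i, ← h2,
    coe_ellSchwartz]
  simp only [hval]

/-- `G` is the inverse transform of the even function `1/m`. -/
theorem IsGreen.even (hP : IsFactorization k c P) (hG : IsGreen k c G)
    (x : EuclideanSpace ℝ (Fin d)) : G (-x) = G x := by
  have hc : Continuous fun x => G (x - 0) • (1 : ℂ) := by
    have := hG.continuous
    fun_prop
  have e := (fourierL2_green hP hG 0 (1 : ℂ)).eq_fourierInv hc (integrable_greenFourier hP hG 0 1)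
  have h1 := congrFun e x
  have h2 := congrFun e (-x)
  rw [Real.fourierInv_eq, ← integral_neg_eq_self] at h1
  rw [Real.fourierInv_eq] at h2
  simp only [greenFourier, ellSymb_neg, inner_zero_left, inner_neg_left] at h1
  simp only [greenFourier, inner_zero_left, inner_neg_right] at h2
  rw [← h1] at h2
  simpa using h2

/-- Convolution with the Green function inverts `ℓ`. -/
theorem integral_green_smul_ell [CompleteSpace F] (hP : IsFactorization k c P)
    (hG : IsGreen k c G) (x : EuclideanSpace ℝ (Fin d)) :
    ∫ z, G z • ell k c (⇑B) (x - z) = B x := by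
  -- Pairing with `w` turns the convolution into an `L²` inner product with `G(· - x) w`; by
  -- Plancherel the factors `m⁻¹` and `m` cancel.
  refine ext_inner_left ℂ fun w => ?_
  have H := fourierL2_green hP hG x w
  have h1 := H.integral_inner (fourierL2_schwartz (ellSchwartz k c B))
  have h2 := integral_inner_fourierChar_smul ((𝓕 B).integrable (μ := volume)) x w
  have h3 : 𝓕⁻ ⇑(𝓕 B : 𝓢(EuclideanSpace ℝ (Fin d), F)) x = B x := by
    rw [← SchwartzMap.fourierInv_coe, fourierInv_fourier_eq]
  have h4 : ∀ ξ, inner ℂ (greenFourier k c x w ξ) ((𝓕 (ellSchwartz k c B)) ξ) =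
      inner ℂ (Real.fourierChar (-inner ℝ x ξ) • w) ((𝓕 B) ξ) := fun ξ => by
    rw [fourier_ellSchwartz_apply, greenFourier, ← Complex.coe_smul, ← Complex.coe_smul,
      inner_smul_left, inner_smul_right, Complex.conj_ofReal, ← mul_assoc, ← Complex.ofReal_mul,
      inv_mul_cancel₀ (ellSymb_pos hP hG ξ).ne', Complex.ofReal_one, one_mul]
  have hi : Integrable fun y => G (y - x) • ellSchwartz k c B y := by
    obtain ⟨C, hC⟩ : ∃ C, ∀ y, ‖ellSchwartz k c B y‖ ≤ C :=
      ⟨_, fun y => SchwartzMap.norm_le_seminorm ℝ _ y⟩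
    have hGi := hG.integrable.comp_sub_right x
    refine (hGi.norm.mul_const C).mono'
      (hGi.1.smul (ellSchwartz k c B).continuous.aestronglyMeasurable) (.of_forall fun y => ?_)
    rw [norm_smul]
    gcongr
    exact hC y
  rw [integral_congr_ae (.of_forall h4), h2.2, h3] at h1
  rw [← h1, ← integral_sub_left_eq_self _ _ x]
  simp only [sub_sub_cancel, ← coe_ellSchwartz]
  have h5 : ∀ y, G (x - y) = G (y - x) := fun y => by rw [← hG.even hP, neg_sub]
  simp only [h5]
  rw [← integral_inner hi]
  refine integral_congr_ae (.of_forall fun y => ?_)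
  simp only [← Complex.coe_smul, inner_smul_left, inner_smul_right, Complex.conj_ofReal]

/-- By the reproducing property this quadratic form is the energy of the kernel expansion with `B =
0`. -/
theorem re_sum_inner_kernel_nonneg [CompleteSpace F] (hP : IsFactorization k c P)
    (hG : IsGreen k c G) :
    0 ≤ (∑ i, inner ℂ (w i) (∑ j, G (xs i - xs j) • w j)).re := by
  have H := fourierL2_kernelExpansion (0 : 𝓢(EuclideanSpace ℝ (Fin d), F)) xs w hP hG
  have he := integrable_energy_kernelFourier (0 : 𝓢(EuclideanSpace ℝ (Fin d), F)) xs w hP hG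
  have h := integral_inner_kernelFourier 0 xs w hP hG H (continuous_kernelExpansion _ _ _ hG)
    (integrable_of_integrable_energy hP hG H.right.1 he)
  have h0 : ellSchwartz k c (0 : 𝓢(EuclideanSpace ℝ (Fin d), F)) = 0 := by
    have hΔ : Δ (0 : 𝓢(EuclideanSpace ℝ (Fin d), F)) = 0 := by
      rw [← SchwartzMap.laplacianCLM_eq', map_zero]
    simp [ellSchwartz, Function.iterate_fixed hΔ]
  simp only [h0, kernelExpansion, zero_apply, inner_zero_left, integral_zero,
    zero_add] at h
  rw [← h.2, ← RCLike.re_eq_complex_re, ← integral_re h.1]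
  refine integral_nonneg fun ξ => ?_
  simp only [Pi.zero_apply]
  rw [← Complex.coe_smul, inner_smul_left, Complex.conj_ofReal, RCLike.re_eq_complex_re,
    Complex.re_ofReal_mul, ← RCLike.re_eq_complex_re]
  exact mul_nonneg (ellSymb_pos hP hG ξ).le inner_self_nonneg

/-- In finite dimension injectivity suffices. If `u + aKΦu = 0`, applying the idempotent `Φ` gives
`w + aKw = 0` for `w = Φu`. Pairing with `w` and using `K ≥ 0` forces `w = 0`, and then `u = 0`. -/
theorem exists_kernel_coefficients [FiniteDimensional ℂ F] (hP : IsFactorization k c P)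
    (hG : IsGreen k c G) {a : ℝ} (ha : 0 < a) (Φ : F →ₗ[ℂ] F)
    (hΦ : ∀ v, Φ (Φ v) = Φ v) (y : ι → F) :
    ∃ u : ι → F, ∀ i, u i + ∑ j, G (xs i - xs j) • (a • Φ (u j)) = y i := by
  have : CompleteSpace F := FiniteDimensional.complete ℂ F
  let T : (ι → F) →ₗ[ℂ] (ι → F) :=
    { toFun := fun u i => u i + ∑ j, G (xs i - xs j) • (a • Φ (u j))
      map_add' := fun u v => by
        ext i
        simp only [Pi.add_apply, map_add, smul_add, Finset.sum_add_distrib]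
        abel
      map_smul' := fun z u => by
        ext i
        simp only [Pi.smul_apply, map_smul, smul_add, Finset.smul_sum, RingHom.id_apply]
        simp only [smul_comm z] }
  suffices hT : Function.Injective T by
    obtain ⟨u, hu⟩ := (LinearMap.injective_iff_surjective.1 hT) y
    exact ⟨u, fun i => congrFun hu i⟩
  rw [injective_iff_map_eq_zero]
  intro u hu
  have h1 : ∀ i, u i + ∑ j, G (xs i - xs j) • (a • Φ (u j)) = 0 := fun i => congrFun hu i
  have h2 : ∀ i, Φ (u i) = 0 := by
    set w : ι → F := fun i => Φ (u i)
    have h3 : ∀ i, w i + (a : ℂ) • ∑ j, G (xs i - xs j) • w j = 0 := fun i => by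
      have := congrArg Φ (h1 i)
      rw [map_add, map_sum, map_zero] at this
      rw [← this, Finset.smul_sum]
      congr 1
      refine Finset.sum_congr rfl fun j _ => ?_
      rw [← Complex.coe_smul (G _), ← Complex.coe_smul a, ← Complex.coe_smul (G _), map_smul,
        map_smul, smul_comm, hΦ]
    have h4 := re_sum_inner_kernel_nonneg xs w hP hG
    have h5 : ∑ i, ‖w i‖ ^ 2 +
        a * (∑ i, inner ℂ (w i) (∑ j, G (xs i - xs j) • w j)).re = 0 := by
      rw [Complex.re_sum, Finset.mul_sum, ← Finset.sum_add_distrib]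
      refine Finset.sum_eq_zero fun i _ => ?_
      have := congrArg (fun v => (inner ℂ (w i) v).re) (h3 i)
      rw [inner_add_right, inner_smul_right, inner_zero_right, Complex.add_re,
        Complex.re_ofReal_mul, Complex.zero_re, ← RCLike.re_eq_complex_re,
        inner_self_eq_norm_sq] at this
      exact this
    have h6 : ∑ i, ‖w i‖ ^ 2 = 0 :=
      le_antisymm (by nlinarith [mul_nonneg ha.le h4]) (Finset.sum_nonneg fun _ _ => by positivity)
    intro i
    have h7 := (Finset.sum_eq_zero_iff_of_nonneg fun i _ => by positivity).1 h6 i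
      (Finset.mem_univ i)
    simpa using h7
  ext i
  simpa [h2] using h1 i

end Energy

/-! ### The compact constraint as a linear system; projection onto `ker A` -/

section Constraint

variable {d n L : ℕ} (M : Machine d n L)

theorem Machine.compactConstraint_eq_zero_iff_forall (x : EuclideanSpace ℝ (Fin d))
    (w : EuclideanSpace ℂ M.Col) :
    M.compactConstraint x w = 0 ↔
      ∀ v, M.TransitionConstraint x w v ∧ M.OutputConstraint x w v := by
  classical
  have h2 : ∑ _v : QVertex L, (2 : ℤ) = 2 * (Fintype.card (QVertex L) : ℤ) := by
    simp [mul_comm]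
  -- Each vertex contributes at most `2`, so the total `2|V|` is reached only if every vertex
  -- attains its maximum.
  rw [Machine.compactConstraint, sub_eq_zero, ← h2,
    Finset.sum_eq_sum_iff_of_le fun v _ => by split_ifs <;> norm_num]
  refine forall_congr' fun v => ?_
  simp only [Finset.mem_univ, forall_const]
  by_cases h1 : M.TransitionConstraint x w v <;> by_cases h2 : M.OutputConstraint x w v <;>
    simp [h1, h2]

theorem Machine.transitionConstraint_iff (x : EuclideanSpace ℝ (Fin d))
    (w : EuclideanSpace ℂ M.Col) (v : QVertex L) :
    M.TransitionConstraint x w v ↔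
      ∀ a, Matrix.toEuclideanLin M.A w (Sum.inl (v, a)) = M.b x (Sum.inl (v, a)) := by
  classical
  rw [Machine.TransitionConstraint, funext_iff]
  refine forall_congr' fun a => ?_
  have h : Matrix.toEuclideanLin M.A w (Sum.inl (v, a)) = M.state w v a -
      (∑ h : QVertex L, if M.arc h v then M.vertexGate v *ᵥ M.state w h else 0) a := by
    simp only [Matrix.toLpLin_apply, Matrix.mulVec, dotProduct, Fintype.sum_sum_type, Machine.A,
      Matrix.fromBlocks_apply₁₁, Matrix.fromBlocks_apply₁₂, Matrix.zero_apply, zero_mul,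
      Finset.sum_const_zero, add_zero, Matrix.sub_apply, sub_mul, Finset.sum_sub_distrib,
      Matrix.one_apply, ite_mul, one_mul, Finset.sum_ite_eq, Finset.mem_univ, if_true,
      Fintype.sum_prod_type, Matrix.of_apply, Finset.sum_apply]
    congr 1
    refine Finset.sum_congr rfl fun h _ => ?_
    split_ifs <;> simp [Matrix.mulVec, dotProduct, Machine.state]
  have hb : M.b x (Sum.inl (v, a)) = M.bias v x a := rfl
  rw [h, hb]
  simp only [Machine.transition, Pi.sub_apply, Pi.add_apply, Pi.zero_apply]
  rw [← sub_sub, sub_eq_zero]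

theorem Machine.outputConstraint_iff (x : EuclideanSpace ℝ (Fin d))
    (w : EuclideanSpace ℂ M.Col) (v : QVertex L) :
    M.OutputConstraint x w v ↔
      ∀ i, Matrix.toEuclideanLin M.A w (Sum.inr ⟨v, i⟩) = M.b x (Sum.inr ⟨v, i⟩) := by
  classical
  rw [Machine.OutputConstraint, funext_iff]
  refine forall_congr' fun i => ?_
  have h : Matrix.toEuclideanLin M.A w (Sum.inr ⟨v, i⟩) =
      (M.stateCon v *ᵥ M.state w v) i + (M.outCon v *ᵥ M.outputValue w v) i := by
    simp only [Matrix.toLpLin_apply, Matrix.mulVec, dotProduct, Fintype.sum_sum_type, Machine.A,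
      Matrix.fromBlocks_apply₂₁, Matrix.fromBlocks_apply₂₂, Fintype.sum_prod_type,
      Fintype.sum_sigma, Matrix.of_apply, Matrix.blockDiagonal'_apply]
    congr 1
    · rw [Finset.sum_eq_single v]
      · simp [Machine.state]
      · intro b _ hb
        simp [hb]
      · simp
    · rw [Finset.sum_eq_single v]
      · simp [Machine.outputValue]
      · intro b _ hb
        simp [hb.symm]
      · simp
  have hb : M.b x (Sum.inr ⟨v, i⟩) = M.outRhs v x i := rfl
  rw [h, hb]
  simp only [Pi.sub_apply, Pi.add_apply, Pi.zero_apply, sub_eq_zero]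

/-- The compact constraint is the linear system `A w = b(x)`. -/
theorem Machine.compactConstraint_eq_zero_iff (x : EuclideanSpace ℝ (Fin d))
    (w : EuclideanSpace ℂ M.Col) :
    M.compactConstraint x w = 0 ↔ Matrix.toEuclideanLin M.A w = M.b x := by
  rw [M.compactConstraint_eq_zero_iff_forall]
  simp only [M.transitionConstraint_iff, M.outputConstraint_iff]
  constructor
  · intro h
    ext i
    rcases i with ⟨v, a⟩ | ⟨v, i⟩
    · exact (h v).1 a
    · exact (h v).2 i
  · intro h v
    rw [h]
    exact ⟨fun _ => rfl, fun _ => rfl⟩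

/-- The right inverse `A† (A A†)⁻¹` of the constraint matrix. -/
noncomputable def rightInv : EuclideanSpace ℂ M.Row →ₗ[ℂ] EuclideanSpace ℂ M.Col :=
  Matrix.toEuclideanLin (M.Aᴴ * (M.A * M.Aᴴ)⁻¹)

variable {M}

theorem toEuclideanLin_mul_apply {l m o : Type*} [Fintype m] [Fintype o] [DecidableEq m]
    [DecidableEq o] (X : Matrix l m ℂ) (Y : Matrix m o ℂ) (v : EuclideanSpace ℂ o) :
    Matrix.toEuclideanLin (X * Y) v = Matrix.toEuclideanLin X (Matrix.toEuclideanLin Y v) := by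
  simp [Matrix.toLpLin_apply, Matrix.mulVec_mulVec]

theorem rightInv_apply (y : EuclideanSpace ℂ M.Row) :
    rightInv M y = Matrix.toEuclideanLin M.Aᴴ (Matrix.toEuclideanLin (M.A * M.Aᴴ)⁻¹ y) :=
  toEuclideanLin_mul_apply _ _ _

theorem A_rightInv (hA : IsUnit (M.A * M.Aᴴ)) (y : EuclideanSpace ℂ M.Row) :
    Matrix.toEuclideanLin M.A (rightInv M y) = y := by
  rw [rightInv, ← toEuclideanLin_mul_apply, ← Matrix.mul_assoc,
    Matrix.mul_nonsing_inv _ ((Matrix.isUnit_iff_isUnit_det _).1 hA)]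
  simp

theorem Phi_apply (v : EuclideanSpace ℂ M.Col) :
    Matrix.toEuclideanLin (Phi M) v = v - rightInv M (Matrix.toEuclideanLin M.A v) := by
  rw [rightInv, ← toEuclideanLin_mul_apply, Phi, map_sub]
  simp

theorem A_Phi (hA : IsUnit (M.A * M.Aᴴ)) (v : EuclideanSpace ℂ M.Col) :
    Matrix.toEuclideanLin M.A (Matrix.toEuclideanLin (Phi M) v) = 0 := by
  rw [Phi_apply, map_sub, A_rightInv hA, sub_self]

theorem Phi_Phi (hA : IsUnit (M.A * M.Aᴴ)) (v : EuclideanSpace ℂ M.Col) :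
    Matrix.toEuclideanLin (Phi M) (Matrix.toEuclideanLin (Phi M) v) =
      Matrix.toEuclideanLin (Phi M) v := by
  rw [Phi_apply (Matrix.toEuclideanLin (Phi M) v), A_Phi hA, map_zero, sub_zero]

/-- The range of `A†` is orthogonal to `ker A`. -/
theorem inner_rightInv {v : EuclideanSpace ℂ M.Col} (hv : Matrix.toEuclideanLin M.A v = 0)
    (y : EuclideanSpace ℂ M.Row) : inner ℂ (rightInv M y) v = 0 := by
  rw [rightInv_apply, Matrix.toEuclideanLin_conjTranspose_eq_adjoint,
    LinearMap.adjoint_inner_left, hv, inner_zero_right]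

theorem inner_Phi {v : EuclideanSpace ℂ M.Col} (hv : Matrix.toEuclideanLin M.A v = 0)
    (u : EuclideanSpace ℂ M.Col) : inner ℂ (Matrix.toEuclideanLin (Phi M) u) v = inner ℂ u v := by
  rw [Phi_apply, inner_sub_left, inner_rightInv hv, sub_zero]

end Constraint

theorem iterate_laplacian_clm_comp {d : ℕ} {F₁ F₂ : Type*} [NormedAddCommGroup F₁]
    [InnerProductSpace ℂ F₁] [NormedAddCommGroup F₂] [InnerProductSpace ℂ F₂]
    (T : F₁ →L[ℝ] F₂) {ψ₁ : 𝓢(EuclideanSpace ℝ (Fin d), F₁)}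
    {ψ₂ : 𝓢(EuclideanSpace ℝ (Fin d), F₂)} (h : ∀ x, ψ₂ x = T (ψ₁ x)) (κ : ℕ)
    (x : EuclideanSpace ℝ (Fin d)) : (Δ^[κ] ψ₂) x = T ((Δ^[κ] ψ₁) x) := by
  induction κ generalizing x with
  | zero => exact h x
  | succ κ ih =>
    rw [Function.iterate_succ_apply', Function.iterate_succ_apply', SchwartzMap.laplacian_apply,
      SchwartzMap.laplacian_apply, show ⇑(Δ^[κ] ψ₂) = T ∘ ⇑(Δ^[κ] ψ₁) from funext ih]
    exact ContDiffAt.laplacian_CLM_comp_left ((Δ^[κ] ψ₁).smooth 2).contDiffAt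

/-- Constant linear maps commute with `ℓ`; this identifies `ℓB` with `A†(A A†)⁻¹ ℓb`. -/
theorem ell_clm_comp {d : ℕ} {F₁ F₂ : Type*} [NormedAddCommGroup F₁]
    [InnerProductSpace ℂ F₁] [NormedAddCommGroup F₂] [InnerProductSpace ℂ F₂]
    (T : F₁ →L[ℝ] F₂) {ψ₁ : 𝓢(EuclideanSpace ℝ (Fin d), F₁)}
    {ψ₂ : 𝓢(EuclideanSpace ℝ (Fin d), F₂)} (h : ∀ x, ψ₂ x = T (ψ₁ x)) (k : ℕ) (c : ℕ → ℝ)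
    (x : EuclideanSpace ℝ (Fin d)) : ell k c (⇑ψ₂) x = T (ell k c (⇑ψ₁) x) := by
  simp only [ell, ← coe_iterate_laplacian, iterate_laplacian_clm_comp T h, map_sum, map_smul]

/-! ### Optimality, representation and Lagrange multipliers -/

section Learning

variable {d n L N r k : ℕ} {M : Machine d n L} {c : ℕ → ℝ} {P : Fin r → MvPolynomial (Fin d) ℂ}
  {G : EuclideanSpace ℝ (Fin d) → ℝ} {γ : ℝ} {xs : Fin N → EuclideanSpace ℝ (Fin d)}
  {ys : Fin N → EuclideanSpace ℂ M.Col}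
  {f : EuclideanSpace ℝ (Fin d) → EuclideanSpace ℂ M.Col}

theorem enforces_iff : M.Enforces f ↔ ∀ x, Matrix.toEuclideanLin M.A (f x) = M.b x :=
  forall_congr' fun x => M.compactConstraint_eq_zero_iff x (f x)

/-- The data of the constraint as Schwartz functions: `b` and the particular solution
`A† (A A†)⁻¹ b`. -/
theorem exists_schwartz_data (hb : ContDiff ℝ ∞ M.b) (hbc : HasCompactSupport M.b) :
    ∃ (b₀ : 𝓢(EuclideanSpace ℝ (Fin d), EuclideanSpace ℂ M.Row))
      (B : 𝓢(EuclideanSpace ℝ (Fin d), EuclideanSpace ℂ M.Col)),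
      ⇑b₀ = M.b ∧ (∀ x, B x = rightInv M (M.b x)) ∧
      ∀ (k : ℕ) (c : ℕ → ℝ) x, ell k c (⇑B) x = rightInv M (ell k c M.b x) := by
  let T : EuclideanSpace ℂ M.Row →L[ℝ] EuclideanSpace ℂ M.Col :=
    (LinearMap.toContinuousLinearMap (rightInv M)).restrictScalars ℝ
  let b₀ := hbc.toSchwartzMap hb
  have hBc : HasCompactSupport fun x => T (M.b x) := hbc.comp_left (g := T) (map_zero T)
  let B := hBc.toSchwartzMap (T.contDiff.comp hb)
  have h0 : ⇑b₀ = M.b := rfl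
  refine ⟨b₀, B, h0, fun x => rfl, fun k c x => ?_⟩
  rw [← h0]
  exact ell_clm_comp T (ψ₁ := b₀) (ψ₂ := B) (fun x => rfl) k c x

/-- The coefficients `Φ χ_κ`. -/
noncomputable def coeffs (M : Machine d n L) (γ : ℝ) (xs : Fin N → EuclideanSpace ℝ (Fin d))
    (ys : Fin N → EuclideanSpace ℂ M.Col)
    (f : EuclideanSpace ℝ (Fin d) → EuclideanSpace ℂ M.Col) (κ : Fin N) :
    EuclideanSpace ℂ M.Col :=
  Matrix.toEuclideanLin (Phi M) (chi M γ xs ys f κ)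

theorem smul_coeffs (hγ : 0 < γ) (κ : Fin N) :
    γ • coeffs M γ xs ys f κ =
      (1 / (N : ℝ)) • Matrix.toEuclideanLin (Phi M) (ys κ - f (xs κ)) := by
  rw [coeffs, chi, LinearMap.map_smul_of_tower, smul_smul]
  congr 1
  field_simp

variable {B : 𝓢(EuclideanSpace ℝ (Fin d), EuclideanSpace ℂ M.Col)}

theorem H_eq (hBell : ∀ x, ell k c (⇑B) x = rightInv M (ell k c M.b x))
    (x : EuclideanSpace ℝ (Fin d)) : H M k c γ x = γ • ell k c (⇑B) x := by
  rw [hBell]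
  rfl

/-- Convolution with `G` undoes `ℓ`, so the integral term is `B`. A fixed-point equation remains,
since the coefficients involve `f` at the data points. -/
theorem representation_iff (hP : IsFactorization k c P) (hG : IsGreen k c G) (hγ : 0 < γ)
    (hBell : ∀ x, ell k c (⇑B) x = rightInv M (ell k c M.b x)) :
    Representation M k c G γ xs ys f ↔
      f = kernelExpansion G B xs (coeffs M γ xs ys f) := by
  have h : ∀ x, (1 / γ) • (∫ z, G z • H M k c γ (x - z)) = B x := fun x => by
    simp only [H_eq hBell, smul_comm (G _) γ]
    rw [integral_smul, smul_smul, one_div_mul_cancel hγ.ne', one_smul]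
    exact integral_green_smul_ell B hP hG x
  simp only [Representation, h]
  exact funext_iff.symm

theorem enforces_kernelExpansion (hA : IsUnit (M.A * M.Aᴴ))
    (hB : ∀ x, B x = rightInv M (M.b x)) (v : Fin N → EuclideanSpace ℂ M.Col) :
    M.Enforces (kernelExpansion G B xs fun κ => Matrix.toEuclideanLin (Phi M) (v κ)) := by
  rw [enforces_iff]
  intro x
  rw [kernelExpansion, map_add, hB, A_rightInv hA, map_sum]
  simp [LinearMap.map_smul_of_tower, A_Phi hA]

/-- Expansion of the functional around a function with the explicit representation. -/
theorem objective_eq_add (hP : IsFactorization k c P) (hG : IsGreen k c G) (hγ : 0 < γ)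
    (hBell : ∀ x, ell k c (⇑B) x = rightInv M (ell k c M.b x))
    (hf : f = kernelExpansion G B xs (coeffs M γ xs ys f)) (hfe : M.Enforces f)
    {g : EuclideanSpace ℝ (Fin d) → EuclideanSpace ℂ M.Col} (hg : Admissible P g)
    (hge : M.Enforces g) :
    objective M P γ xs ys g = objective M P γ xs ys f + γ / 2 * energy P (fun x => g x - f x) +
      1 / (2 * (N : ℝ)) * ∑ κ, ‖g (xs κ) - f (xs κ)‖ ^ 2 := by
  have hE := energy_eq_add_energy_sub B xs (coeffs M γ xs ys f) hP hG hg
  rw [← hf] at hE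
  have hv : ∀ x, Matrix.toEuclideanLin M.A (g x - f x) = 0 := fun x => by
    rw [map_sub, enforces_iff.1 hge, enforces_iff.1 hfe, sub_self]
  have h1 : ∫ x, inner ℂ (ellSchwartz k c B x) (g x - f x) = 0 := by
    refine integral_eq_zero_of_ae (.of_forall fun x => ?_)
    simp only [coe_ellSchwartz, hBell, inner_rightInv (hv x), Pi.zero_apply]
  -- Against values in `ker A` the projection `Φ` can be dropped.
  have h2 : ∀ κ, inner ℂ (coeffs M γ xs ys f κ) (g (xs κ) - f (xs κ)) =
      ((1 / ((N : ℝ) * γ) : ℝ) : ℂ) * inner ℂ (ys κ - f (xs κ)) (g (xs κ) - f (xs κ)) :=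
    fun κ => by
      rw [coeffs, inner_Phi (hv _), chi, ← Complex.coe_smul, inner_smul_left, Complex.conj_ofReal]
  have h3 : ∀ κ, ‖g (xs κ) - ys κ‖ ^ 2 = ‖f (xs κ) - ys κ‖ ^ 2 + ‖g (xs κ) - f (xs κ)‖ ^ 2 -
      2 * (inner ℂ (ys κ - f (xs κ)) (g (xs κ) - f (xs κ))).re := fun κ => by
    have := norm_sub_sq (𝕜 := ℂ) (ys κ - f (xs κ)) (g (xs κ) - f (xs κ))
    rw [sub_sub_sub_cancel_right, norm_sub_rev (ys κ), norm_sub_rev (ys κ)] at this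
    rw [this, RCLike.re_eq_complex_re]
    ring
  simp only [h1, h2, zero_add, Complex.re_sum, Complex.re_ofReal_mul, ← Finset.mul_sum] at hE
  -- The cross term of the energy has weight `(γ/2) · 2 · 1/(Nγ) = 1/N`, that of the loss `-2/(2N)`;
  -- they cancel.
  rw [objective, objective, hE]
  simp only [h3, Finset.sum_sub_distrib, Finset.sum_add_distrib, ← Finset.mul_sum]
  rcases Nat.eq_zero_or_pos N with hN | hN
  · subst hN
    simp
    ring
  · have : (0 : ℝ) < N := by exact_mod_cast hN
    field_simp
    ring

/-- The unknowns of the finite system are the residuals `u κ = ys κ - f (xs κ)`. -/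
theorem exists_representation (hA : IsUnit (M.A * M.Aᴴ)) (hP : IsFactorization k c P)
    (hG : IsGreen k c G) (hγ : 0 < γ) (hN : 0 < N)
    (B : 𝓢(EuclideanSpace ℝ (Fin d), EuclideanSpace ℂ M.Col))
    (xs : Fin N → EuclideanSpace ℝ (Fin d)) (ys : Fin N → EuclideanSpace ℂ M.Col) :
    ∃ f, f = kernelExpansion G B xs (coeffs M γ xs ys f) := by
  have ha : 0 < 1 / ((N : ℝ) * γ) := by
    have : (0 : ℝ) < N := by exact_mod_cast hN
    positivity
  obtain ⟨u, hu⟩ := exists_kernel_coefficients xs hP hG ha (Matrix.toEuclideanLin (Phi M))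
    (Phi_Phi hA) (fun κ => ys κ - B (xs κ))
  refine ⟨kernelExpansion G B xs fun κ =>
    (1 / ((N : ℝ) * γ)) • Matrix.toEuclideanLin (Phi M) (u κ), ?_⟩
  congr 1
  ext1 κ
  rw [coeffs, chi, LinearMap.map_smul_of_tower]
  congr 2
  rw [kernelExpansion, ← sub_sub, ← hu κ]
  exact (add_sub_cancel_right _ _).symm

theorem integral_ell_smul_of_representation (hP : IsFactorization k c P) (hG : IsGreen k c G)
    (hγ : 0 < γ) (hBell : ∀ x, ell k c (⇑B) x = rightInv M (ell k c M.b x))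
    (g : EuclideanSpace ℝ (Fin d) → EuclideanSpace ℂ M.Col)
    (φ : 𝓢(EuclideanSpace ℝ (Fin d), ℂ)) :
    γ • (∫ x, ell k c (⇑φ) x • kernelExpansion G B xs (coeffs M γ xs ys g) x) =
      (∫ x, φ x • H M k c γ x) +
        (1 / (N : ℝ)) • ∑ κ, φ (xs κ) • Matrix.toEuclideanLin (Phi M) (ys κ - g (xs κ)) := by
  have h1 : ∫ x, φ x • H M k c γ x = γ • ∫ x, φ x • ell k c (⇑B) x := by
    simp only [H_eq hBell, smul_comm (φ _) γ]
    exact integral_smul _ _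
  rw [integral_ell_smul_kernelExpansion B xs _ hP hG, smul_add, h1, Finset.smul_sum,
    Finset.smul_sum]
  congr 1
  refine Finset.sum_congr rfl fun κ _ => ?_
  rw [smul_comm γ, smul_coeffs hγ, smul_comm (φ _)]

/-- The expansion with coefficients read off from `f` solves the same equation with the same
right-hand side, and `ℓ` is injective on the difference. -/
theorem eq_kernelExpansion_of_reduced (hP : IsFactorization k c P) (hG : IsGreen k c G)
    (hγ : 0 < γ) (hBell : ∀ x, ell k c (⇑B) x = rightInv M (ell k c M.b x))
    (hf : Admissible P f) (hr : ReducedEulerLagrange M k c γ xs ys f) :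
    f = kernelExpansion G B xs (coeffs M γ xs ys f) := by
  have hs := hf.sub hP (admissible_kernelExpansion B xs (coeffs M γ xs ys f) hP hG)
  refine sub_eq_zero.1 (eq_zero_of_forall_integral_ell_smul_eq_zero hP hG hs.1 hs.2.1 fun φ => ?_)
  have h1 := hr φ
  rw [← integral_ell_smul_of_representation hP hG hγ hBell f φ] at h1
  have h2 := smul_right_injective _ hγ.ne' h1
  have hi : ∀ {g : EuclideanSpace ℝ (Fin d) → EuclideanSpace ℂ M.Col}, MemLp g 2 volume →
      Integrable fun x => ell k c (⇑φ) x • g x := fun hg => by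
    rw [← coe_ellSchwartz]
    exact hg.integrable_schwartz_smul _
  simp only [Pi.sub_apply, smul_sub]
  rw [integral_sub (hi hf.2.1) (hi (fourierL2_kernelExpansion B xs _ hP hG).left), sub_eq_zero]
  exact h2

/-- With the explicit multiplier the Euler–Lagrange equation is the reduced one. -/
theorem eulerLagrange_multiplier_iff
    {b₀ : 𝓢(EuclideanSpace ℝ (Fin d), EuclideanSpace ℂ M.Row)} (hb₀ : ⇑b₀ = M.b)
    (φ : 𝓢(EuclideanSpace ℝ (Fin d), ℂ)) :
    γ • (∫ x, ell k c (⇑φ) x • f x) +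
        Matrix.toEuclideanLin M.Aᴴ (multiplier M k c γ xs ys f φ)
      + (1 / (N : ℝ)) • ∑ κ, φ (xs κ) • (f (xs κ) - ys κ) = 0 ↔
    γ • (∫ x, ell k c (⇑φ) x • f x) = (∫ x, φ x • H M k c γ x)
      + (1 / (N : ℝ)) • ∑ κ, φ (xs κ) • Matrix.toEuclideanLin (Phi M) (ys κ - f (xs κ)) := by
  have hint : Integrable fun x => φ x • ell k c M.b x := by
    rw [← hb₀, ← coe_ellSchwartz]
    exact ((ellSchwartz k c b₀).memLp 2 volume).integrable_schwartz_smul φ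
  have hH : ∫ x, φ x • H M k c γ x = γ • rightInv M (∫ x, φ x • ell k c M.b x) := by
    rw [← LinearMap.coe_toContinuousLinearMap', ← ContinuousLinearMap.integral_comp_comm _ hint,
      ← integral_smul]
    refine integral_congr_ae (.of_forall fun x => ?_)
    simp only [LinearMap.coe_toContinuousLinearMap', map_smul]
    rw [smul_comm]
    rfl
  have hm : Matrix.toEuclideanLin M.Aᴴ (multiplier M k c γ xs ys f φ) =
      -(∫ x, φ x • H M k c γ x) - (1 / (N : ℝ)) • ∑ κ, φ (xs κ) •
        rightInv M (Matrix.toEuclideanLin M.A (f (xs κ) - ys κ)) := by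
    rw [multiplier, map_neg, ← rightInv_apply, map_add, LinearMap.map_smul_of_tower,
      LinearMap.map_smul_of_tower, hH, map_sum]
    simp only [map_smul]
    abel
  have hs : ∑ κ, φ (xs κ) • Matrix.toEuclideanLin (Phi M) (ys κ - f (xs κ)) =
      ∑ κ, φ (xs κ) • rightInv M (Matrix.toEuclideanLin M.A (f (xs κ) - ys κ)) -
        ∑ κ, φ (xs κ) • (f (xs κ) - ys κ) := by
    rw [← Finset.sum_sub_distrib]
    refine Finset.sum_congr rfl fun κ _ => ?_
    rw [← smul_sub, ← neg_sub (f (xs κ)) (ys κ), map_neg, Phi_apply, neg_sub]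
  rw [hm, hs, smul_sub, ← sub_eq_zero (a := γ • _)]
  refine Eq.congr_left ?_
  abel

/-- Apply `A`: integration by parts and `A f = b` replace `A ℓ f` by `ℓ b`, and `A A†` can be
inverted. Optimality of `f` is not needed. -/
theorem eq_multiplier_of_eulerLagrange (hA : IsUnit (M.A * M.Aᴴ))
    {b₀ : 𝓢(EuclideanSpace ℝ (Fin d), EuclideanSpace ℂ M.Row)} (hb₀ : ⇑b₀ = M.b)
    (hf : MemLp f 2 volume) (hfe : M.Enforces f)
    {lam : 𝓢'(EuclideanSpace ℝ (Fin d), EuclideanSpace ℂ M.Row)}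
    (h : EulerLagrange M k c γ xs ys f lam) (φ : 𝓢(EuclideanSpace ℝ (Fin d), ℂ)) :
    lam φ = multiplier M k c γ xs ys f φ := by
  have hint : Integrable fun x => ell k c (⇑φ) x • f x := by
    rw [← coe_ellSchwartz]
    exact hf.integrable_schwartz_smul _
  have h1 : Matrix.toEuclideanLin M.A (∫ x, ell k c (⇑φ) x • f x) =
      ∫ x, φ x • ell k c M.b x := by
    rw [← hb₀, ← integral_ell_smul_schwartz, hb₀, ← LinearMap.coe_toContinuousLinearMap',
      ← ContinuousLinearMap.integral_comp_comm _ hint]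
    refine integral_congr_ae (.of_forall fun x => ?_)
    simp only [LinearMap.coe_toContinuousLinearMap', map_smul, enforces_iff.1 hfe]
  have h2 := congrArg (Matrix.toEuclideanLin M.A) (h φ)
  rw [map_add, map_add, map_zero, LinearMap.map_smul_of_tower, h1, LinearMap.map_smul_of_tower,
    map_sum, ← toEuclideanLin_mul_apply] at h2
  simp only [map_smul] at h2
  rw [add_right_comm, add_comm, add_eq_zero_iff_eq_neg] at h2
  rw [multiplier, ← map_neg, ← h2, ← toEuclideanLin_mul_apply,
    Matrix.nonsing_inv_mul _ ((Matrix.isUnit_iff_isUnit_det _).1 hA)]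
  simp

/-- The formula is a linear image of a Schwartz function and finitely many point masses, hence
continuous in `φ`. -/
theorem exists_multiplier {b₀ : 𝓢(EuclideanSpace ℝ (Fin d), EuclideanSpace ℂ M.Row)}
    (hb₀ : ⇑b₀ = M.b) (k : ℕ) (c : ℕ → ℝ) (γ : ℝ) (xs : Fin N → EuclideanSpace ℝ (Fin d))
    (ys : Fin N → EuclideanSpace ℂ M.Col)
    (f : EuclideanSpace ℝ (Fin d) → EuclideanSpace ℂ M.Col) :
    ∃ lam : 𝓢'(EuclideanSpace ℝ (Fin d), EuclideanSpace ℂ M.Row),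
      ∀ φ, lam φ = multiplier M k c γ xs ys f φ := by
  let S : 𝓢(EuclideanSpace ℝ (Fin d), ℂ) →L[ℂ] EuclideanSpace ℂ M.Row :=
    SchwartzMap.toTemperedDistributionCLM (EuclideanSpace ℝ (Fin d)) (EuclideanSpace ℂ M.Row)
      volume (ellSchwartz k c b₀)
  let D : Fin N → 𝓢(EuclideanSpace ℝ (Fin d), ℂ) →L[ℂ] EuclideanSpace ℂ M.Row := fun κ =>
    ContinuousLinearMap.smulRight (TemperedDistribution.delta (xs κ) :
      𝓢(EuclideanSpace ℝ (Fin d), ℂ) →L[ℂ] ℂ) (Matrix.toEuclideanLin M.A (f (xs κ) - ys κ))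
  let T := LinearMap.toContinuousLinearMap (Matrix.toEuclideanLin (M.A * M.Aᴴ)⁻¹)
  refine ⟨(-(T.comp ((γ : ℂ) • S + ((1 / (N : ℝ) : ℝ) : ℂ) • ∑ κ, D κ)) :
    𝓢(EuclideanSpace ℝ (Fin d), ℂ) →L[ℂ] EuclideanSpace ℂ M.Row), fun φ => ?_⟩
  have hS : S φ = ∫ x, φ x • ell k c M.b x := by
    rw [← hb₀, ← coe_ellSchwartz]
    exact SchwartzMap.toTemperedDistributionCLM_apply_apply volume (ellSchwartz k c b₀) φ
  have hD : ∀ κ, D κ φ = φ (xs κ) • Matrix.toEuclideanLin M.A (f (xs κ) - ys κ) := fun κ => rfl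
  have hlam : (-(T.comp ((γ : ℂ) • S + ((1 / (N : ℝ) : ℝ) : ℂ) • ∑ κ, D κ)) :
      𝓢(EuclideanSpace ℝ (Fin d), ℂ) →L[ℂ] EuclideanSpace ℂ M.Row) φ =
      -T ((γ : ℂ) • S φ + ((1 / (N : ℝ) : ℝ) : ℂ) • ∑ κ, D κ φ) := by
    simp
  refine hlam.trans ?_
  simp only [hS, hD, Complex.coe_smul]
  rfl

end Learning

end QNNLearning

/-! ### The main theorem -/

open QNNLearning in
theorem mainTheorem1 {d n L N r : ℕ} (M : Machine d n L)
    (hA : IsUnit (M.A * M.Aᴴ))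
    (hb : ContDiff ℝ ∞ M.b) (hbc : HasCompactSupport M.b)
    (k : ℕ) (c : ℕ → ℝ) (P : Fin r → MvPolynomial (Fin d) ℂ) (hP : IsFactorization k c P)
    (G : EuclideanSpace ℝ (Fin d) → ℝ) (hG : IsGreen k c G)
    (hN : 0 < N) (xs : Fin N → EuclideanSpace ℝ (Fin d))
    (ys : Fin N → EuclideanSpace ℂ M.Col) :
    (∀ x w, M.compactConstraint x w = 0 ↔ Matrix.toEuclideanLin M.A w = M.b x) ∧
    0 < ∫ x, G x ∧
    ∀ γ : ℝ, 0 < γ →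
      (∃! f, IsOptimal M P γ xs ys f) ∧
      (∀ f, IsOptimal M P γ xs ys f ↔ Representation M k c G γ xs ys f) ∧
      (∀ f, IsOptimal M P γ xs ys f ↔
        (Admissible P f ∧ M.Enforces f ∧ ∃ lam, EulerLagrange M k c γ xs ys f lam)) ∧
      (∀ f, IsOptimal M P γ xs ys f ↔
        (Admissible P f ∧ ReducedEulerLagrange M k c γ xs ys f)) ∧
      (∀ f, IsOptimal M P γ xs ys f → ∀ lam,
        EulerLagrange M k c γ xs ys f lam ↔ ∀ φ, lam φ = multiplier M k c γ xs ys f φ) := by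
  refine ⟨M.compactConstraint_eq_zero_iff, hG.integral_pos hP, fun γ hγ => ?_⟩
  obtain ⟨b₀, B, hb₀, hB, hBell⟩ := exists_schwartz_data hb hbc
  have hBell := hBell k c
  have hrep := fun f => representation_iff (xs := xs) (ys := ys) (f := f) hP hG hγ hBell
  have hgood : ∀ f, Representation M k c G γ xs ys f → Admissible P f ∧ M.Enforces f := by
    intro f hf
    have he := (hrep f).1 hf
    rw [he]
    exact ⟨admissible_kernelExpansion B xs _ hP hG, enforces_kernelExpansion hA hB _⟩
  have hadd := fun {f} (hf : Representation M k c G γ xs ys f) {g} (hg : Admissible P g)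
    (hge : M.Enforces g) =>
      objective_eq_add hP hG hγ hBell ((hrep f).1 hf) (hgood f hf).2 hg hge
  have hN' : (0 : ℝ) < N := by exact_mod_cast hN
  have hopt : ∀ f, Representation M k c G γ xs ys f → IsOptimal M P γ xs ys f := by
    intro f hf
    refine ⟨hgood f hf, fun g hg hge => ?_⟩
    rw [hadd hf hg hge, add_assoc]
    have := energy_nonneg (P := P) fun x => g x - f x
    exact le_add_of_nonneg_right (by positivity)
  have huniq : ∀ f g, Representation M k c G γ xs ys f → IsOptimal M P γ xs ys g → g = f := by
    intro f g hf hg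
    have h1 := hadd hf hg.1.1 hg.1.2
    have h2 := hg.2 f (hgood f hf).1 (hgood f hf).2
    have h3 := energy_nonneg (P := P) fun x => g x - f x
    have h4 : 0 ≤ 1 / (2 * (N : ℝ)) * ∑ κ, ‖g (xs κ) - f (xs κ)‖ ^ 2 := by positivity
    -- The objective at `g` exceeds that at `f` by two nonnegative terms, yet `g` is optimal, so
    -- both terms vanish.
    have h5 : energy P (fun x => g x - f x) = 0 := by nlinarith
    exact sub_eq_zero.1 ((hg.1.1.sub hP (hgood f hf).1).eq_zero_of_energy_eq_zero hP hG h5)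
  obtain ⟨f₀, hf₀⟩ : ∃ f, Representation M k c G γ xs ys f :=
    (exists_representation hA hP hG hγ hN B xs ys).imp fun f hf => (hrep f).2 hf
  have hoi : ∀ f, IsOptimal M P γ xs ys f ↔ Representation M k c G γ xs ys f := fun f =>
    ⟨fun h => by rw [huniq f₀ f hf₀ h]; exact hf₀, hopt f⟩
  have hred : ∀ f, IsOptimal M P γ xs ys f ↔
      (Admissible P f ∧ ReducedEulerLagrange M k c γ xs ys f) := by
    intro f
    rw [hoi]
    refine ⟨fun h => ⟨(hgood f h).1, fun φ => ?_⟩, fun h =>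
      (hrep f).2 (eq_kernelExpansion_of_reduced hP hG hγ hBell h.1 h.2)⟩
    have := integral_ell_smul_of_representation (xs := xs) (ys := ys) hP hG hγ hBell f φ
    rwa [← (hrep f).1 h] at this
  have hEL : ∀ f lam, (∀ φ, lam φ = multiplier M k c γ xs ys f φ) →
      (EulerLagrange M k c γ xs ys f lam ↔ ReducedEulerLagrange M k c γ xs ys f) := by
    intro f lam hlam
    refine forall_congr' fun φ => ?_
    rw [hlam]
    exact eulerLagrange_multiplier_iff hb₀ φ
  refine ⟨⟨f₀, hopt f₀ hf₀, fun g hg => huniq f₀ g hf₀ hg⟩, hoi, fun f => ⟨fun h => ?_, ?_⟩, hred,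
    fun f hf lam => ⟨fun h => eq_multiplier_of_eulerLagrange hA hb₀ hf.1.1.2.1 hf.1.2 h,
      fun h => (hEL f lam h).2 ((hred f).1 hf).2⟩⟩
  · obtain ⟨lam, hlam⟩ := exists_multiplier hb₀ k c γ xs ys f
    exact ⟨h.1.1, h.1.2, lam, (hEL f lam hlam).2 ((hred f).1 h).2⟩
  · rintro ⟨ha, he, lam, h⟩
    -- Any multiplier is forced to be the explicit one, so it may be eliminated before `f` is known
    -- to be optimal.
    exact (hred f).2 ⟨ha, (hEL f lam (eq_multiplier_of_eulerLagrange hA hb₀ ha.2.1 he h)).1 h⟩
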